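/- Let $g\ge 1$ and $$S=\{(s_0,\dots,s_{2g-2})\in\mathbb C^{2g-1}\;:\; s_i\neq 0,1,\ s_i\neq s_j \text{ for } i\neq j\}.$$ For $s\in S$ let $Y_s$ be the smooth completion (with one point at infinity) of the affine curve $$y^2=f_s(x):=x(x-1)(x-s_0)\cdots(x-s_{2g-2}),$$ a curve of genus $g$; these curves form a family $\mathcal Y\to S$. Let $\iota(x,y)=(x,-y)$ be the hyperelliptic involution of $Y_s$. A quadratic differential $q\in\Gamma(Y_s,\Omega_{Y_s}^{\otimes 2})$ is called odd if $\iota^*q=-q$. The Kodaira–Spencer map of the family at $s$ is viewed as a linear map $$\theta\colon T_S(s)=\mathbb C^{2g-1}\to\Gamma(Y_s,\Omega_{Y_s}^{\otimes 2})^\vee,\qquad \partial\mapsto\theta_\partial,$$ through the duality of $H^1(Y_s,T_{Y_s})$ and $\Gamma(Y_s,\Omega_{Y_s}^{\otimes 2})$. Explicitly, let $D$ be a meromorphic lift of $\partial$ to $\mathcal Y$ along $Y_s$, and for each point $P\in Y_s$ let $D_P$ be such a lift which is regular at $P$; then $D_P-D$ is a meromorphic vector field on $Y_s$, and $$\theta_\partial(q)=\sum_{P\in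 Y_s}\operatorname{Res}_P\big((D_P-D)\,\lrcorner\, q\big),$$ a sum with finitely many nonzero terms, whose value does not depend on the choice of the lifts. Let $s\in S$. Then: 1. For each $i=0,\dots,2g-2$ there is a nonzero number $c_i=c_i(s)\in\mathbb C$ such that for all $j=0,\dots,2g-2$ the form $\frac{x^j\,\mathrm dx^2}{y^2}$ is a regular quadratic differential on $Y_s$ and $$\theta_{\partial/\partial s_i}\Big(\frac{x^j\,\mathrm dx^2}{y^2}\Big)=c_i\,s_i^{\,j}.$$ 2. For each $i=0,\dots,2g-2$ and each integer $j$ with $0\le j\le g-3$, the form $\frac{x^j\,\mathrm dx^2}{y}$ is a regular quadratic differential on $Y_s$ and $$\theta_{\partial/\partial s_i}\Big(\frac{x^j\,\mathrm dx^2}{y}\Big)=0.$$ 3. $\theta$ is an isomorphism from $T_S(s)$ onto the space of linear functionals on $\Gamma(Y_s,\Omega_{Y_s}^{\otimes 2})$ that vanish on the subspace of odd quadratic differentials. -/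

import Mathlib

open Polynomial

noncomputable section

namespace HyperellipticKS

/-- The base `S` of the family: points `s = (s_0, …, s_{2g-2})` of `ℂ^{2g-1}` whose coordinates are
different from `0` and `1` and pairwise distinct.  It is open in `ℂ^{2g-1}`, so that its tangent
space at each point is `ℂ^{2g-1} = (Fin (2 * g - 1) → ℂ)`. -/
def Base (g : ℕ) : Type :=
  {s : Fin (2 * g - 1) → ℂ // (∀ i, s i ≠ 0 ∧ s i ≠ 1) ∧ Function.Injective s}

/-- The tangent space of the base at any of its points. -/
abbrev Tangent (g : ℕ) : Type := Fin (2 * g - 1) → ℂ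

/-- `f_s = x (x - 1) (x - s_0) ⋯ (x - s_{2g-2})`. -/
def famPoly {g : ℕ} (s : Fin (2 * g - 1) → ℂ) : ℂ[X] :=
  X * (X - 1) * ∏ i, (X - C (s i))

/-- The derivative `∂_v f` of `f_s` with respect to the parameter `s`, in the direction `v`;
see `hasDerivAt_famPoly`. -/
def famPolyDeriv {g : ℕ} (s v : Fin (2 * g - 1) → ℂ) : ℂ[X] :=
  ∑ i, C (-v i) * (X * (X - 1) * ∏ k ∈ Finset.univ.erase i, (X - C (s k)))

theorem hasDerivAt_famPoly {g : ℕ} (s v : Fin (2 * g - 1) → ℂ) (z : ℂ) :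
    HasDerivAt (fun ε : ℂ => (famPoly (s + ε • v)).eval z) ((famPolyDeriv s v).eval z) 0 := by
  have h : ∀ i ∈ (Finset.univ : Finset (Fin (2 * g - 1))),
      HasDerivAt (fun ε : ℂ => z - (s i + ε * v i)) (-v i) 0 := by
    intro i _
    have := (((hasDerivAt_id (0 : ℂ)).mul_const (v i)).const_add (s i)).const_sub z
    simpa using this
  have h2 := (HasDerivAt.fun_finsetProd h).const_mul (z * (z - 1))
  refine (h2.congr_deriv ?_).congr_of_eventuallyEq (Filter.Eventually.of_forall fun ε => ?_)
  · simp only [famPolyDeriv, eval_finsetSum, eval_mul, eval_C, eval_X, eval_sub, eval_one,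
      eval_prod, Finset.mul_sum, smul_eq_mul, zero_mul, add_zero]
    exact Finset.sum_congr rfl fun i _ => by ring
  · simp [famPoly, eval_prod]

/-- The equation `Y² - f_s` over the field `ℂ(x)`. -/
def curveEq {g : ℕ} (s : Base g) : (RatFunc ℂ)[X] :=
  X ^ 2 - C (algebraMap ℂ[X] (RatFunc ℂ) (famPoly s.1))

theorem curveEq_eq {g : ℕ} (s : Base g) :
    curveEq s = X ^ 2 - C (algebraMap ℂ[X] (RatFunc ℂ) (famPoly s.1)) := rfl

theorem curveEq_irreducible {g : ℕ} (s : Base g) : Irreducible (curveEq s) := by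
  have key : ∀ r : RatFunc ℂ, r ^ 2 ≠ algebraMap ℂ[X] (RatFunc ℂ) (famPoly s.1) := by
    intro r hr
    have hint : IsIntegral ℂ[X] r := by
      refine ⟨X ^ 2 - C (famPoly s.1), monic_X_pow_sub_C _ two_ne_zero, ?_⟩
      simp [hr]
    obtain ⟨p, rfl⟩ := IsIntegrallyClosed.isIntegral_iff.mp hint
    have hp : p ^ 2 = famPoly s.1 := by
      apply RatFunc.algebraMap_injective ℂ
      rw [map_pow, hr]
    have h0 : p.eval 0 = 0 := by
      have := congrArg (eval 0) hp
      simpa [famPoly] using this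
    obtain ⟨q, rfl⟩ := X_dvd_iff.mpr ((coeff_zero_eq_eval_zero p).trans h0)
    have hq : X * q ^ 2 = (X - 1) * ∏ i, (X - C (s.1 i)) := by
      apply mul_left_cancel₀ (X_ne_zero (R := ℂ))
      rw [← mul_assoc X (X - 1)]
      calc X * (X * q ^ 2) = (X * q) ^ 2 := by ring
        _ = _ := hp
    have h1 := congrArg (eval 0) hq
    simp [eval_prod] at h1
    have := (Finset.prod_eq_zero_iff).mp h1
    obtain ⟨i, _, hi⟩ := this
    exact (s.2.1 i).1 (by simpa using hi)
  refine (X_pow_sub_C_irreducible_iff_of_prime Nat.prime_two).mpr ?_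
  exact key

instance {g : ℕ} (s : Base g) : Fact (Irreducible (curveEq s)) := ⟨curveEq_irreducible s⟩

-- Only for the speed of elaboration: `curveEq_eq` is the definition.
attribute [irreducible] curveEq

/-- The function field `ℂ(Y_s) = ℂ(x)[y] / (y² - f_s(x))` of the curve `Y_s`. -/
abbrev FunField {g : ℕ} (s : Base g) : Type := AdjoinRoot (curveEq s)

variable {g : ℕ} (s : Base g)

/-- The function `x` on `Y_s`. -/
def xFun : FunField s := algebraMap (RatFunc ℂ) (FunField s) RatFunc.X

/-- The function `y` on `Y_s`. -/
def yFun : FunField s := AdjoinRoot.root (curveEq s)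

theorem yFun_sq : yFun s ^ 2 =
    algebraMap (RatFunc ℂ) (FunField s) (algebraMap ℂ[X] (RatFunc ℂ) (famPoly s.1)) := by
  have h := AdjoinRoot.eval₂_root (curveEq s)
  have h2 : ∀ p : (RatFunc ℂ)[X], p = curveEq s →
      p.eval₂ (AdjoinRoot.of (curveEq s)) (AdjoinRoot.root (curveEq s)) = 0 := by
    rintro p rfl
    exact h
  have h3 := h2 _ (curveEq_eq s).symm
  rw [eval₂_sub, eval₂_pow, eval₂_X, eval₂_C, sub_eq_zero] at h3
  exact h3

/-- The points of the smooth completion `Y_s`: those of the affine curve `b² = f_s(a)` (which is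
smooth, as `f_s` has no multiple root), and one point at infinity.  Around the latter, `Y_s` is the
smooth affine curve `v² = u (1 - u) (1 - s_0 u) ⋯ (1 - s_{2g-2} u)` with `u = 1 / x`,
`v = y / x^(g+1)`, and the point at infinity is `u = v = 0`. -/
inductive Point : Type
  | affine (a b : ℂ) (h : b ^ 2 = (famPoly s.1).eval a) : Point
  | infinity : Point

/-- First coordinate function (`x` or `u`) of the affine chart used around a point. -/
def Point.coordOne {s : Base g} : Point s → FunField s
  | .affine _ _ _ => xFun s
  | .infinity => (xFun s)⁻¹

/-- Second coordinate function (`y` or `v`) of the affine chart used around a point. -/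
def Point.coordTwo {s : Base g} : Point s → FunField s
  | .affine _ _ _ => yFun s
  | .infinity => yFun s / xFun s ^ (g + 1)

/-- The values of the two coordinate functions at a point. -/
def Point.value {s : Base g} : Point s → ℂ × ℂ
  | .affine a b _ => (a, b)
  | .infinity => (0, 0)

/-- A Laurent series `∑ a_n t^n` without polar part. -/
def NoPole (p : LaurentSeries ℂ) : Prop := ∀ n : ℤ, n < 0 → p.coeff n = 0

/-- A (formal) local parameter `t` at a point `P` of `Y_s`, given by the expansion of the
meromorphic functions on `Y_s` as Laurent series in `t`: the expansion is a ring
homomorphism that is the identity on constants, the coordinate functions around `P` have no pole and take the right values at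
`t = 0`, and some function has order `1`. -/
structure LocalParam {s : Base g} (P : Point s) where
  expand : FunField s →+* LaurentSeries ℂ
  expand_const : ∀ c : ℂ, expand (algebraMap ℂ (FunField s) c) = HahnSeries.C c
  noPole_one : NoPole (expand P.coordOne)
  noPole_two : NoPole (expand P.coordTwo)
  value_one : (expand P.coordOne).coeff 0 = P.value.1
  value_two : (expand P.coordTwo).coeff 0 = P.value.2
  order_one : ∃ h : FunField s, (expand h).order = 1

/-- The derivative `dx/dt`, as a Laurent series in the local parameter `t`. -/
def LocalParam.dx {s : Base g} {P : Point s} (t : LocalParam P) : LaurentSeries ℂ :=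
  LaurentSeries.derivative ℂ (t.expand (xFun s))

/-- A function `h` is regular at `P`. -/
def RegularAt {s : Base g} (P : Point s) (h : FunField s) : Prop :=
  ∀ t : LocalParam P, NoPole (t.expand h)

/-- The residue at `P` of the meromorphic `1`-form `h dx`, calculated with the local parameter `t`:
the coefficient of `t^(-1)` in `h (dx/dt)`. -/
def LocalParam.residue {s : Base g} {P : Point s} (t : LocalParam P) (h : FunField s) : ℂ :=
  (t.expand h * t.dx).coeff (-1)

/-- `Γ(Y_s, Ω^{⊗2})`, the space of (regular) quadratic differentials on `Y_s`.  As every meromorphic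
quadratic differential is uniquely of the form `h dx²` with `h` in the function field, we represent
it by `h`; it is regular at `P` when `h (dx/dt)²` has no pole at `P`, with `t` a local parameter. -/
def QuadDiff : Submodule ℂ (FunField s) where
  carrier := {h | ∀ (P : Point s) (t : LocalParam P), NoPole (t.expand h * t.dx ^ 2)}
  add_mem' {a b} ha hb := fun P t n hn => by
    rw [map_add, add_mul, HahnSeries.coeff_add, ha P t n hn, hb P t n hn, add_zero]
  zero_mem' := fun P t n _ => by simp
  smul_mem' c a ha := fun P t n hn => by
    rw [Algebra.smul_def, map_mul, t.expand_const, mul_assoc, HahnSeries.C_mul_eq_smul,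
      HahnSeries.coeff_smul, ha P t n hn, smul_zero]

/-- The action on functions of the hyperelliptic involution `(x, y) ↦ (x, -y)`. -/
def hypInv : FunField s →ₐ[RatFunc ℂ] FunField s :=
  AdjoinRoot.liftAlgHom (curveEq s) (Algebra.ofId (RatFunc ℂ) (FunField s)) (-yFun s) (by
    have h := yFun_sq s
    have h2 : ∀ p : (RatFunc ℂ)[X],
        X ^ 2 - C (algebraMap ℂ[X] (RatFunc ℂ) (famPoly s.1)) = p →
        p.eval₂ (algebraMap (RatFunc ℂ) (FunField s)) (-yFun s) = 0 := by
      rintro p rfl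
      rw [eval₂_sub, eval₂_pow, eval₂_X, eval₂_C, neg_sq, h, sub_self]
    exact h2 _ (curveEq_eq s).symm)

/-- The odd quadratic differentials, those on which the hyperelliptic involution `ι` acts as `-1`
(as `ι^* x = x`, one has `ι^* (h dx²) = (ι^* h) dx²`). -/
def OddQuadDiff : Submodule ℂ (QuadDiff s) where
  carrier := {q | hypInv s q = -(q : FunField s)}
  add_mem' {a b} ha hb := by
    simp only [Set.mem_ofPred_eq, Submodule.coe_add, map_add, neg_add] at *
    rw [ha, hb]
  zero_mem' := by simp
  smul_mem' c a ha := by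
    simp only [Set.mem_ofPred_eq, Submodule.coe_smul] at *
    rw [← algebraMap_smul (RatFunc ℂ) c (a : FunField s), map_smul, ha, smul_neg]

/-- A meromorphic lift, along the fibre `Y_s`, of a tangent vector `v` of the base at `s` to the
total space `y² = f_s(x)` of the family.  A meromorphic vector field with components
`(v, xdot, ydot)` in the coordinates `(s, x, y)` along `Y_s` is tangent to the total space when it
kills `y² - f_s(x)`. -/
structure Lift (v : Tangent g) where
  xdot : FunField s
  ydot : FunField s
  tangent : 2 * yFun s * ydot =
    aeval (xFun s) (derivative (famPoly s.1)) * xdot + aeval (xFun s) (famPolyDeriv s.1 v)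

/-- The lift is regular at the point `P` of `Y_s`, as a vector field on the total space (glued from
the charts `(s, x, y)` and `(s, u, v) = (s, 1 / x, y / x^(g+1))`): its components in the coordinates
around `P` are regular at `P`. -/
def Lift.RegularAt {s : Base g} {v : Tangent g} (D : Lift s v) (P : Point s) : Prop :=
  match P with
  | .affine a b h =>
      HyperellipticKS.RegularAt (.affine a b h) D.xdot ∧
      HyperellipticKS.RegularAt (.affine a b h) D.ydot
  | .infinity =>
      HyperellipticKS.RegularAt (.infinity : Point s) (-D.xdot / xFun s ^ 2) ∧
      HyperellipticKS.RegularAt (.infinity : Point s)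
        (D.ydot / xFun s ^ (g + 1) - (g + 1) * yFun s * D.xdot / xFun s ^ (g + 2))

/-- The choices that enter the calculation of the Kodaira–Spencer map in the direction `v`: a global
meromorphic lift of `v`, for each point `P` of `Y_s` a lift which is regular at `P`, and local
parameters.  The differences `loc P - glob` are meromorphic vector fields on the fibre `Y_s`, namely
`((loc P).xdot - glob.xdot) ∂/∂x`; modulo fields regular at `P` and modulo a common meromorphic
field on `Y_s` they represent the Kodaira–Spencer class of `v` in `H¹(Y_s, T_{Y_s})`. -/
structure LiftData (v : Tangent g) where
  glob : Lift s v
  loc : ∀ _P : Point s, Lift s v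
  loc_regular : ∀ P, (loc P).RegularAt P
  param : ∀ P : Point s, LocalParam P

/-- The residue at `P` of the `1`-form obtained by contracting the vector field `loc P - glob` on
`Y_s` with the quadratic differential `h dx²`. -/
def LiftData.term {s : Base g} {v : Tangent g} (d : LiftData s v) (h : FunField s)
    (P : Point s) : ℂ :=
  (d.param P).residue (((d.loc P).xdot - d.glob.xdot) * h)

/-- `θ` is the Kodaira–Spencer map of the family at `s`, viewed as a map from the tangent space
`T_S(s)` to the dual of `Γ(Y_s, Ω^{⊗2})` (Serre duality with `H¹(Y_s, T_{Y_s})`): for all `v` and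
`q`, `θ v q` is the sum over the points of `Y_s` of the residues of `(loc P - glob) ⌟ q`, only
finitely many being nonzero.  It is required that such lifts exist and that every choice of them
gives this value, so that at most one `θ` has the property. -/
def IsKodairaSpencer (θ : Tangent g →ₗ[ℂ] Module.Dual ℂ (QuadDiff s)) : Prop :=
  ∀ v : Tangent g, Nonempty (LiftData s v) ∧
    ∀ (d : LiftData s v) (q : QuadDiff s),
      (Function.support (d.term (q : FunField s))).Finite ∧
      θ v q = ∑ᶠ P : Point s, d.term (q : FunField s) P

end HyperellipticKS

end

noncomputable section

namespace HyperellipticKS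


/-! The core is a local formula: `θ_v (h dx²) = ∑ v_i Res_{P_i} (h dx)`, where `P_i` is the branch
point above `s_i` (`finsum_term_eq`). The global lift contributes the sum of all residues of one
meromorphic form on `Y_s`, which is zero (`residueTheorem`). A lift that is regular at an affine
unramified point or at infinity has an `x`-component that is regular as a vector field on the fibre,
so its contraction with a regular `h dx²` has no residue. At a branch point `(a, 0)` the tangency
relation `2 y ẏ = f' ẋ + ∂_v f` forces `ẋ` to take the value `-∂_v f(a) / f'(a)`, the velocity of
the moving root: `v_i` at `s_i`, and `0` at the fixed roots `0` and `1`. The rest of `ẋ` vanishes at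
the point, which compensates the simple zero of `dx` (`residue_lift_branch`).

The three claims then become residue calculations at the `P_i`. Odd differentials have `h = B(x) y`;
as `y` is a uniformizer at `P_i` and `x` is even in it, `B(x) y dx` has no residue there. For `h =
x^j / y²` the residue is `2 s_i^j / f'(s_i)`. The even differentials are exactly the `p(x) dx² / y²`
with `deg p ≤ 2g - 2` (`exists_polyFun_div_of_even`), so the pairing of tangent vectors with even
monomials is a Vandermonde matrix times an invertible diagonal one. This gives injectivity and, by
equality of dimensions, the range.

A local parameter is only an embedding of the function field into Laurent series for which some
function has order `1`. The orders of `x - a`, `y` and `dx` are therefore derived from the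
decomposition `A(x) + B(x) y`: see `eq_one_of_sqrt`, `hasOrder_expand_linFrac`, `hasOrder_branch`
and `hasOrder_infinity`. The residue theorem rests on the same decomposition: partial fractions
treat `A(x) dx`, and the residues of `B(x) y dx` at conjugate points cancel. -/

/-! ### Orders and residues of Laurent series -/

/-- All coefficients of `p` below `n` vanish. -/
def OrderGE (p : LaurentSeries ℂ) (n : ℤ) : Prop := (n : WithTop ℤ) ≤ p.orderTop

/-- The Laurent series `p` is nonzero and has order `n`. -/
def HasOrder (p : LaurentSeries ℂ) (n : ℤ) : Prop := p.orderTop = (n : WithTop ℤ)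

theorem noPole_iff {p : LaurentSeries ℂ} : NoPole p ↔ OrderGE p 0 := by
  rw [OrderGE, HahnSeries.le_orderTop_iff_forall]
  simp [NoPole]

theorem orderGE_iff {p : LaurentSeries ℂ} {n : ℤ} : OrderGE p n ↔ ∀ m < n, p.coeff m = 0 := by
  rw [OrderGE, HahnSeries.le_orderTop_iff_forall]
  simp

theorem HasOrder.orderGE {p : LaurentSeries ℂ} {n : ℤ} (h : HasOrder p n) : OrderGE p n :=
  h.symm.le

theorem OrderGE.mono {p : LaurentSeries ℂ} {n m : ℤ} (h : OrderGE p n) (hm : m ≤ n) :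
    OrderGE p m :=
  le_trans (by exact_mod_cast hm) h

theorem OrderGE.add {p q : LaurentSeries ℂ} {n : ℤ} (hp : OrderGE p n) (hq : OrderGE q n) :
    OrderGE (p + q) n :=
  (le_min hp hq).trans HahnSeries.min_orderTop_le_orderTop_add

theorem OrderGE.neg {p : LaurentSeries ℂ} {n : ℤ} (hp : OrderGE p n) : OrderGE (-p) n := by
  rwa [OrderGE, HahnSeries.orderTop_neg]

theorem OrderGE.sub {p q : LaurentSeries ℂ} {n : ℤ} (hp : OrderGE p n) (hq : OrderGE q n) :
    OrderGE (p - q) n := by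
  rw [sub_eq_add_neg]; exact hp.add hq.neg

theorem OrderGE.mul {p q : LaurentSeries ℂ} {n m : ℤ} (hp : OrderGE p n) (hq : OrderGE q m) :
    OrderGE (p * q) (n + m) := by
  rw [OrderGE, HahnSeries.orderTop_mul, WithTop.coe_add]
  exact add_le_add hp hq

theorem orderGE_zero (n : ℤ) : OrderGE 0 n := by simp [OrderGE]

theorem HasOrder.ne_zero {p : LaurentSeries ℂ} {n : ℤ} (h : HasOrder p n) : p ≠ 0 := by
  rintro rfl
  simp [HasOrder] at h

theorem hasOrder_iff {p : LaurentSeries ℂ} {n : ℤ} : HasOrder p n ↔ p ≠ 0 ∧ p.order = n := by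
  constructor
  · intro h
    refine ⟨h.ne_zero, ?_⟩
    have := HahnSeries.order_eq_orderTop_of_ne_zero h.ne_zero
    rw [h] at this
    exact_mod_cast this
  · rintro ⟨h, rfl⟩
    exact (HahnSeries.order_eq_orderTop_of_ne_zero h).symm

theorem exists_hasOrder {p : LaurentSeries ℂ} (h : p ≠ 0) : ∃ n, HasOrder p n :=
  ⟨p.order, hasOrder_iff.mpr ⟨h, rfl⟩⟩

theorem HasOrder.unique {p : LaurentSeries ℂ} {n m : ℤ} (h : HasOrder p n) (h' : HasOrder p m) :
    n = m := by
  have := h.symm.trans h'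
  exact_mod_cast this

theorem HasOrder.le {p : LaurentSeries ℂ} {n m : ℤ} (h : HasOrder p n) (h' : OrderGE p m) :
    m ≤ n := by
  have := le_trans h' (Eq.le h)
  exact_mod_cast this

theorem HasOrder.mul {p q : LaurentSeries ℂ} {n m : ℤ} (hp : HasOrder p n) (hq : HasOrder q m) :
    HasOrder (p * q) (n + m) := by
  rw [HasOrder, HahnSeries.orderTop_mul, WithTop.coe_add, hp, hq]

theorem hasOrder_single {a : ℂ} (ha : a ≠ 0) (n : ℤ) : HasOrder (HahnSeries.single n a) n :=
  HahnSeries.orderTop_single ha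

theorem hasOrder_C {a : ℂ} (ha : a ≠ 0) : HasOrder (HahnSeries.C a) 0 :=
  HahnSeries.orderTop_single ha

theorem orderGE_C (a : ℂ) : OrderGE (HahnSeries.C a) 0 := by
  rcases eq_or_ne a 0 with rfl | h
  · simpa using orderGE_zero 0
  · exact (hasOrder_C h).orderGE

theorem hasOrder_one : HasOrder 1 0 := by
  simpa using hasOrder_C one_ne_zero

theorem HasOrder.inv {p : LaurentSeries ℂ} {n : ℤ} (hp : HasOrder p n) : HasOrder p⁻¹ (-n) := by
  obtain ⟨m, hm⟩ := exists_hasOrder (inv_ne_zero hp.ne_zero)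
  have h := hp.mul hm
  rw [mul_inv_cancel₀ hp.ne_zero] at h
  have := h.unique hasOrder_one
  rwa [show -n = m by omega]

theorem HasOrder.div {p q : LaurentSeries ℂ} {n m : ℤ} (hp : HasOrder p n) (hq : HasOrder q m) :
    HasOrder (p / q) (n - m) := by
  rw [div_eq_mul_inv, sub_eq_add_neg]
  exact hp.mul hq.inv

theorem HasOrder.pow {p : LaurentSeries ℂ} {n : ℤ} (hp : HasOrder p n) (k : ℕ) :
    HasOrder (p ^ k) (k * n) := by
  induction k with
  | zero => simpa using hasOrder_one
  | succ k ih =>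
    rw [pow_succ]
    convert ih.mul hp using 1
    push_cast; ring

theorem HasOrder.zpow {p : LaurentSeries ℂ} {n : ℤ} (hp : HasOrder p n) (k : ℤ) :
    HasOrder (p ^ k) (k * n) := by
  obtain ⟨k, rfl | rfl⟩ := k.eq_nat_or_neg
  · simpa using hp.pow k
  · rw [zpow_neg, zpow_natCast, neg_mul]
    exact (hp.pow k).inv

theorem OrderGE.div {p q : LaurentSeries ℂ} {n m : ℤ} (hp : OrderGE p n) (hq : HasOrder q m) :
    OrderGE (p / q) (n - m) := by
  rw [div_eq_mul_inv, sub_eq_add_neg]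
  exact hp.mul hq.inv.orderGE

theorem HasOrder.add_of_lt {p q : LaurentSeries ℂ} {n m : ℤ} (hp : HasOrder p n)
    (hq : OrderGE q m) (h : n < m) : HasOrder (p + q) n := by
  have : p.orderTop < q.orderTop := by
    rw [hp]
    exact lt_of_lt_of_le (by exact_mod_cast h) hq
  rw [HasOrder, HahnSeries.orderTop_add_eq_left this, hp]

theorem HasOrder.coeff_ne_zero {p : LaurentSeries ℂ} {n : ℤ} (hp : HasOrder p n) :
    p.coeff n ≠ 0 := by
  obtain ⟨h, rfl⟩ := hasOrder_iff.mp hp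
  exact HahnSeries.coeff_order_eq_zero.not.mpr h

theorem OrderGE.succ {p : LaurentSeries ℂ} {n : ℤ} (hp : OrderGE p n) (h : p.coeff n = 0) :
    OrderGE p (n + 1) := by
  rw [orderGE_iff] at *
  intro m hm
  rcases eq_or_ne m n with rfl | h'
  · exact h
  · exact hp m (by omega)

theorem OrderGE.hasOrder {p : LaurentSeries ℂ} {n : ℤ} (hp : OrderGE p n) (h : p.coeff n ≠ 0) :
    HasOrder p n := by
  have h0 : p ≠ 0 := by rintro rfl; simp at h
  obtain ⟨m, hm⟩ := exists_hasOrder h0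
  have h1 := hm.le hp
  rcases h1.eq_or_lt with rfl | h2
  · exact hm
  · exact absurd (orderGE_iff.mp hm.orderGE n h2) h

/-- The leading coefficient is multiplicative. -/
theorem coeff_mul_of_orderGE {p q : LaurentSeries ℂ} {n m : ℤ} (hp : OrderGE p n)
    (hq : OrderGE q m) : (p * q).coeff (n + m) = p.coeff n * q.coeff m := by
  have h1 := hp.sub (q := HahnSeries.single n (p.coeff n)) HahnSeries.orderTop_single_le
  have h2 : OrderGE (p - HahnSeries.single n (p.coeff n)) (n + 1) := h1.succ (by simp)
  have h3 := orderGE_iff.mp (h2.mul hq) (n + m) (by omega)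
  rw [sub_mul, HahnSeries.coeff_sub, sub_eq_zero] at h3
  rw [h3, HahnSeries.coeff_single_mul]
  congr 2; ring

/-! ### Derivatives and residues of Laurent series. -/

/-- The Euler operator `t d/dt` on Laurent series. -/
def eulerOp (p : LaurentSeries ℂ) : LaurentSeries ℂ :=
  HahnSeries.single 1 1 * LaurentSeries.derivative ℂ p

theorem coeff_eulerOp (p : LaurentSeries ℂ) (n : ℤ) : (eulerOp p).coeff n = n * p.coeff n := by
  rw [eulerOp, HahnSeries.coeff_single_mul, LaurentSeries.derivative_apply,
    LaurentSeries.hasseDeriv_coeff]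
  simp

/-- The operator multiplies the `n`-th coefficient by `n`, and `n = i + j` on the antidiagonal. It
does not enlarge supports, so all three products are sums over the same antidiagonal. This is why
Leibniz is proved for `t d/dt` before `d/dt`. -/
theorem eulerOp_mul (p q : LaurentSeries ℂ) :
    eulerOp (p * q) = p * eulerOp q + q * eulerOp p := by
  have hs : ∀ p, (eulerOp p).support ⊆ p.support := by
    intro p n hn
    rw [HahnSeries.mem_support, coeff_eulerOp] at hn
    exact right_ne_zero_of_mul hn
  ext n
  rw [mul_comm q, coeff_eulerOp, HahnSeries.coeff_add, HahnSeries.coeff_mul,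
    HahnSeries.coeff_mul_right' q.isPWO_support (hs q),
    HahnSeries.coeff_mul_left' p.isPWO_support (hs p), Finset.mul_sum, ← Finset.sum_add_distrib]
  refine Finset.sum_congr rfl fun ij hij => ?_
  rw [Finset.mem_antidiagonal] at hij
  rw [coeff_eulerOp, coeff_eulerOp, ← hij.2.2]
  push_cast
  ring

/-- The derivative of Laurent series. -/
def laurentDeriv (p : LaurentSeries ℂ) : LaurentSeries ℂ := LaurentSeries.derivative ℂ p

theorem laurentDeriv_add (p q : LaurentSeries ℂ) :
    laurentDeriv (p + q) = laurentDeriv p + laurentDeriv q := map_add _ p q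

theorem laurentDeriv_sub (p q : LaurentSeries ℂ) :
    laurentDeriv (p - q) = laurentDeriv p - laurentDeriv q := map_sub _ p q

theorem laurentDeriv_mul (p q : LaurentSeries ℂ) :
    laurentDeriv (p * q) = p * laurentDeriv q + q * laurentDeriv p := by
  have h := eulerOp_mul p q
  have h0 : (HahnSeries.single (1 : ℤ) (1 : ℂ)) ≠ 0 := (hasOrder_single one_ne_zero 1).ne_zero
  apply mul_left_cancel₀ h0
  refine h.trans ?_
  simp only [eulerOp, laurentDeriv]
  ring

theorem coeff_laurentDeriv (p : LaurentSeries ℂ) (n : ℤ) :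
    (laurentDeriv p).coeff n = (n + 1) * p.coeff (n + 1) := by
  rw [laurentDeriv, LaurentSeries.derivative_apply, LaurentSeries.hasseDeriv_coeff]
  simp

theorem laurentDeriv_C (a : ℂ) : laurentDeriv (HahnSeries.C a) = 0 :=
  by
  ext n
  rw [coeff_laurentDeriv, HahnSeries.coeff_zero, HahnSeries.C_apply, HahnSeries.coeff_single]
  split_ifs with h
  · rw [show (n : ℂ) + 1 = ((n + 1 : ℤ) : ℂ) by push_cast; rfl, h]; simp
  · simp

theorem laurentDeriv_pow (p : LaurentSeries ℂ) (n : ℕ) :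
    laurentDeriv (p ^ (n + 1)) = HahnSeries.C (n + 1 : ℂ) * (p ^ n * laurentDeriv p) := by
  induction n with
  | zero => simp
  | succ n ih =>
    rw [pow_succ, laurentDeriv_mul, ih]
    simp only [Nat.cast_succ, map_add, map_one]
    ring

/-- Negative exponents come from differentiating `p^n (p^n)⁻¹ = 1`. -/
theorem laurentDeriv_zpow {p : LaurentSeries ℂ} (hp : p ≠ 0) (n : ℤ) :
    laurentDeriv (p ^ n) = HahnSeries.C (n : ℂ) * (p ^ (n - 1) * laurentDeriv p) := by
  have h1 : laurentDeriv 1 = 0 := by simpa using laurentDeriv_C 1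
  have pos : ∀ n : ℕ, laurentDeriv (p ^ n) * p = HahnSeries.C (n : ℂ) * (p ^ n * laurentDeriv p) := by
    rintro (_ | n)
    · simp [h1]
    · rw [laurentDeriv_pow]; push_cast; ring
  apply mul_right_cancel₀ hp
  rw [zpow_sub_one₀ hp]
  obtain ⟨n, rfl | rfl⟩ := n.eq_nat_or_neg
  · rw [zpow_natCast, pos]
    push_cast
    field_simp
  · have h := laurentDeriv_mul (p ^ n) (p ^ n)⁻¹
    rw [mul_inv_cancel₀ (pow_ne_zero n hp), h1] at h
    have h2 := pos n
    have h3 : (HahnSeries.C ((-(n : ℤ) : ℤ) : ℂ) : LaurentSeries ℂ) = -HahnSeries.C (n : ℂ) := by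
      rw [Int.cast_neg, Int.cast_natCast, map_neg]
    rw [zpow_neg, zpow_natCast, h3]
    have h4 : (p ^ n)⁻¹ * p ^ n = 1 := inv_mul_cancel₀ (pow_ne_zero n hp)
    have h5 : p⁻¹ * p = 1 := inv_mul_cancel₀ hp
    generalize (p ^ n)⁻¹ = q at *
    apply mul_left_cancel₀ (pow_ne_zero n hp)
    linear_combination (-p) * h - q * h2 + HahnSeries.C (n : ℂ) * laurentDeriv p * p ^ n * q * h5

theorem residue_laurentDeriv (p : LaurentSeries ℂ) : (laurentDeriv p).coeff (-1) = 0 := by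
  rw [coeff_laurentDeriv]; simp

theorem OrderGE.laurentDeriv {p : LaurentSeries ℂ} {n : ℤ} (hp : OrderGE p n) :
    OrderGE (HyperellipticKS.laurentDeriv p) (n - 1) := by
  rw [orderGE_iff] at *
  intro m hm
  rw [coeff_laurentDeriv, hp _ (by omega), mul_zero]

/-- The general bound loses one order; a derivative never has a `t⁻¹` term, which restores it. -/
theorem OrderGE.laurentDeriv_of_zero {p : LaurentSeries ℂ} (hp : OrderGE p 0) :
    OrderGE (HyperellipticKS.laurentDeriv p) 0 :=
  hp.laurentDeriv.succ (by simp [coeff_laurentDeriv])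

theorem HasOrder.laurentDeriv {p : LaurentSeries ℂ} {n : ℤ} (hp : HasOrder p n) (hn : n ≠ 0) :
    HasOrder (HyperellipticKS.laurentDeriv p) (n - 1) := by
  refine hp.orderGE.laurentDeriv.hasOrder ?_
  rw [coeff_laurentDeriv, sub_add_cancel]
  refine mul_ne_zero ?_ hp.coeff_ne_zero
  push_cast
  simpa using hn

/-- The residue of `p^n dp` vanishes for `n ≠ -1`. -/
theorem residue_zpow_mul_deriv {p : LaurentSeries ℂ} (hp : p ≠ 0) {n : ℤ} (hn : n ≠ -1) :
    (p ^ n * laurentDeriv p).coeff (-1) = 0 := by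
  have h := laurentDeriv_zpow hp (n + 1)
  have h0 : ((n + 1 : ℤ) : ℂ) ≠ 0 := by
    rw [Int.cast_ne_zero]; omega
  have h3 := residue_laurentDeriv (p ^ (n + 1))
  rw [h, add_sub_cancel_right, HahnSeries.C_mul_eq_smul, HahnSeries.coeff_smul, smul_eq_mul] at h3
  exact (mul_eq_zero.mp h3).resolve_left h0

/-- The residue of `dp / p` is the order of `p`. -/
theorem HasOrder.residue_logDeriv {p : LaurentSeries ℂ} {n : ℤ} (hp : HasOrder p n) :
    (p⁻¹ * HyperellipticKS.laurentDeriv p).coeff (-1) = n := by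
  have h := coeff_mul_of_orderGE hp.inv.orderGE hp.orderGE.laurentDeriv
  have h1 := coeff_mul_of_orderGE hp.inv.orderGE hp.orderGE
  rw [inv_mul_cancel₀ hp.ne_zero, neg_add_cancel, HahnSeries.coeff_one, if_pos rfl] at h1
  rw [show -n + (n - 1) = -1 by ring, coeff_laurentDeriv, sub_add_cancel] at h
  rw [h, mul_left_comm, ← h1]
  push_cast; ring

theorem OrderGE.residue_eq_zero {p : LaurentSeries ℂ} (hp : OrderGE p 0) :
    p.coeff (-1) = 0 :=
  orderGE_iff.mp hp _ (by omega)


/-! ### Rational functions in one variable -/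

/-- The linear polynomial `x - a` as a rational function. -/
def linFrac (a : ℂ) : RatFunc ℂ := algebraMap ℂ[X] (RatFunc ℂ) (X - C a)

theorem linFrac_ne_zero (a : ℂ) : linFrac a ≠ 0 :=
  (map_ne_zero_iff _ (RatFunc.algebraMap_injective ℂ)).mpr (X_sub_C_ne_zero a)

theorem linFrac_eq (a : ℂ) : linFrac a = RatFunc.X - RatFunc.C a := by
  simp [linFrac]

/-- Nonzero rational functions are generated multiplicatively by constants and linear
polynomials. -/
theorem ratFunc_mul_induction {p : RatFunc ℂ → Prop} (const : ∀ c : ℂ, c ≠ 0 → p (RatFunc.C c))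
    (lin : ∀ a, p (linFrac a)) (mul : ∀ A B, p A → p B → p (A * B))
    (inv : ∀ A, p A → p A⁻¹) {A : RatFunc ℂ} (hA : A ≠ 0) : p A := by
  have poly : ∀ q : ℂ[X], q ≠ 0 → p (algebraMap ℂ[X] (RatFunc ℂ) q) := by
    intro q hq
    have key : ∀ m : Multiset ℂ, p (algebraMap ℂ[X] (RatFunc ℂ) (m.map fun a => X - C a).prod) := by
      intro m
      induction m using Multiset.induction with
      | empty => simpa using const 1 one_ne_zero
      | cons a m ih =>
        rw [Multiset.map_cons, Multiset.prod_cons, map_mul]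
        exact mul _ _ (lin a) ih
    rw [(IsAlgClosed.splits q).eq_prod_roots, map_mul]
    refine mul _ _ ?_ (key _)
    simpa using const _ (leadingCoeff_ne_zero.mpr hq)
  rw [← RatFunc.num_div_denom A, div_eq_mul_inv]
  exact mul _ _ (poly _ (RatFunc.num_ne_zero hA)) (inv _ (poly _ (RatFunc.denom_ne_zero A)))

/-- Partial fractions: rational functions are linear combinations of powers of `x` and of
negative powers of the `x - a`. -/
theorem ratFunc_partialFraction_induction {p : RatFunc ℂ → Prop}
    (add : ∀ A B, p A → p B → p (A + B)) (smul : ∀ (c : ℂ) A, p A → p (RatFunc.C c * A))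
    (X_pow : ∀ n : ℕ, p (RatFunc.X ^ n)) (lin : ∀ (a : ℂ) (n : ℕ), p (linFrac a ^ (-(n + 1 : ℤ))))
    (A : RatFunc ℂ) : p A := by
  -- `q` is the smallest predicate with the four closure properties, that is, membership in the
  -- span. Unlike an arbitrary `p`, it can be shown to be stable under multiplication and division
  -- by linear factors, and so holds everywhere by `ratFunc_mul_induction`.
  let q : RatFunc ℂ → Prop := fun A => ∀ p : RatFunc ℂ → Prop,
    (∀ A B, p A → p B → p (A + B)) → (∀ (c : ℂ) A, p A → p (RatFunc.C c * A)) →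
    (∀ n : ℕ, p (RatFunc.X ^ n)) → (∀ (a : ℂ) (n : ℕ), p (linFrac a ^ (-(n + 1 : ℤ)))) → p A
  suffices h : q A from h p add smul X_pow lin
  have qadd : ∀ A B, q A → q B → q (A + B) := fun A B hA hB p h1 h2 h3 h4 =>
    h1 _ _ (hA p h1 h2 h3 h4) (hB p h1 h2 h3 h4)
  have qsmul : ∀ (c : ℂ) A, q A → q (RatFunc.C c * A) := fun c A hA p h1 h2 h3 h4 =>
    h2 _ _ (hA p h1 h2 h3 h4)
  have qsub : ∀ A B, q A → q B → q (A - B) := by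
    intro A B hA hB
    have h1 := qadd _ _ hA (qsmul (-1) _ hB)
    rwa [map_neg, map_one, neg_one_mul, ← sub_eq_add_neg] at h1
  have qpow : ∀ n : ℕ, q (RatFunc.X ^ n) := fun n p h1 h2 h3 h4 => h3 n
  have qlin : ∀ (a : ℂ) (n : ℕ), q (linFrac a ^ (-(n + 1 : ℤ))) := fun a n p h1 h2 h3 h4 => h4 a n
  have qlin' : ∀ (a : ℂ) (n : ℕ), q (linFrac a ^ (-(n : ℤ))) := by
    rintro a (_ | n)
    · simpa using qpow 0
    · simpa using qlin a n
  -- Stability under multiplication by `x - b` and by its inverse.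
  have mulLin : ∀ b A, q A → q (linFrac b * A) := by
    intro b A hA
    refine hA (fun A => q (linFrac b * A)) ?_ ?_ ?_ ?_
    · intro A B hA hB; rw [mul_add]; exact qadd _ _ hA hB
    · intro c A hA; rw [mul_left_comm]; exact qsmul _ _ hA
    · intro n
      have := qsub _ _ (qpow (n + 1)) (qsmul b _ (qpow n))
      rwa [pow_succ', ← sub_mul, ← linFrac_eq] at this
    · intro a n
      have h0 := linFrac_ne_zero a
      have h1 := qadd _ _ (qlin' a n) (qsmul (a - b) _ (qlin a n))
      have h2 : linFrac b * linFrac a ^ (-(n + 1 : ℤ)) =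
          linFrac a ^ (-(n : ℤ)) + RatFunc.C (a - b) * linFrac a ^ (-(n + 1 : ℤ)) := by
        have h3 : linFrac b = linFrac a + RatFunc.C (a - b) := by
          rw [linFrac_eq, linFrac_eq, map_sub]; ring
        rw [h3, add_mul, show (-(n : ℤ)) = 1 + -(n + 1 : ℤ) by ring, zpow_add₀ h0, zpow_one]
      rwa [h2]
  have divLin : ∀ b A, q A → q ((linFrac b)⁻¹ * A) := by
    intro b A hA
    have hb := linFrac_ne_zero b
    refine hA (fun A => q ((linFrac b)⁻¹ * A)) ?_ ?_ ?_ ?_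
    · intro A B hA hB; rw [mul_add]; exact qadd _ _ hA hB
    · intro c A hA; rw [mul_left_comm]; exact qsmul _ _ hA
    · intro n
      induction n with
      | zero => simpa using qlin b 0
      | succ n ih =>
        -- `x^(n+1) / (x - b) = x^n + b x^n / (x - b)`.
        have h1 := qadd _ _ (qpow n) (qsmul b _ ih)
        convert h1 using 1
        have h3 : RatFunc.X = linFrac b + RatFunc.C b := by rw [linFrac_eq]; ring
        rw [pow_succ']
        nth_rewrite 1 [h3]
        field_simp
    · intro a n
      rcases eq_or_ne a b with rfl | hab
      · have h1 := qlin a (n + 1)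
        have h2 : (linFrac a)⁻¹ * linFrac a ^ (-(n + 1 : ℤ)) =
            linFrac a ^ (-((n + 1 : ℕ) + 1 : ℤ)) := by
          rw [← zpow_neg_one, ← zpow_add₀ hb]
          congr 1; push_cast; ring
        rwa [h2]
      · have ha := linFrac_ne_zero a
        have hd : RatFunc.C (b - a) ≠ (0 : RatFunc ℂ) := by
          rw [Ne, map_eq_zero_iff _ (RatFunc.C_injective (K := ℂ)), sub_eq_zero]
          exact hab.symm
        have hba : RatFunc.C (b - a) = linFrac a - linFrac b := by
          rw [linFrac_eq, linFrac_eq, map_sub]; ring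
        have hci : (RatFunc.C (b - a)⁻¹ : RatFunc ℂ) = (RatFunc.C (b - a))⁻¹ := map_inv₀ _ _
        have key : ∀ n : ℕ, q ((linFrac b)⁻¹ * linFrac a ^ (-(n : ℤ))) := by
          intro n
          induction n with
          | zero => simpa using qlin b 0
          | succ n ih =>
            -- Since `b - a = (x - a) - (x - b)`, a product of poles at `a` and `b` splits into
            -- terms with one pole fewer.
            have h1 := qsmul (b - a)⁻¹ _ (qsub _ _ ih (qlin a n))
            convert h1 using 1
            have h4 : linFrac a ^ (-(n : ℤ)) = linFrac a * linFrac a ^ (-(n + 1 : ℤ)) := by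
              rw [← zpow_one_add₀ ha]; congr 1; ring
            rw [hci, h4]
            push_cast
            generalize linFrac a ^ (-(n + 1 : ℤ)) = w
            rw [eq_inv_mul_iff_mul_eq₀ hd, hba]
            field_simp
        exact_mod_cast key (n + 1)
  have mulBoth : ∀ B : RatFunc ℂ, B ≠ 0 → (∀ A, q A → q (B * A)) ∧ (∀ A, q A → q (B⁻¹ * A)) := by
    intro B hB
    refine ratFunc_mul_induction (p := fun B => (∀ A, q A → q (B * A)) ∧ (∀ A, q A → q (B⁻¹ * A)))
      ?_ ?_ ?_ ?_ hB
    · intro c hc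
      exact ⟨qsmul c, fun A hA => by rw [← map_inv₀]; exact qsmul _ A hA⟩
    · exact fun a => ⟨mulLin a, divLin a⟩
    · rintro A B ⟨h1, h2⟩ ⟨h3, h4⟩
      refine ⟨fun D hD => ?_, fun D hD => ?_⟩
      · rw [mul_assoc]; exact h1 _ (h3 _ hD)
      · rw [mul_inv, mul_assoc]; exact h2 _ (h4 _ hD)
    · rintro A ⟨h1, h2⟩
      exact ⟨h2, by rwa [inv_inv]⟩
  rcases eq_or_ne A 0 with rfl | hA
  · simpa using qsmul 0 _ (qpow 0)
  · simpa using (mulBoth A hA).1 _ (qpow 0)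

/-! ### The polynomial `f_s` and its variation -/

section famPoly

variable {g : ℕ} (s : Base g)

/-- The quotient of `f_s` by `x - s_i`. -/
def famQuot (i : Fin (2 * g - 1)) : ℂ[X] :=
  X * (X - 1) * ∏ k ∈ Finset.univ.erase i, (X - C (s.1 k))

theorem famPoly_eq_mul_famQuot (i : Fin (2 * g - 1)) :
    famPoly s.1 = (X - C (s.1 i)) * famQuot s i := by
  rw [famPoly, famQuot, ← Finset.mul_prod_erase Finset.univ _ (Finset.mem_univ i)]
  ring

theorem famQuot_eval_self (i : Fin (2 * g - 1)) : (famQuot s i).eval (s.1 i) ≠ 0 := by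
  simp only [famQuot, eval_mul, eval_X, eval_sub, eval_one, eval_prod, eval_C]
  refine mul_ne_zero (mul_ne_zero (s.2.1 i).1 (sub_ne_zero.mpr (s.2.1 i).2)) ?_
  rw [Finset.prod_ne_zero_iff]
  intro k hk
  rw [sub_ne_zero]
  exact fun h => (Finset.ne_of_mem_erase hk) (s.2.2 h).symm

theorem famQuot_eval_ne {i k : Fin (2 * g - 1)} (h : k ≠ i) :
    (famQuot s i).eval (s.1 k) = 0 := by
  simp only [famQuot, eval_mul, eval_prod]
  rw [Finset.prod_eq_zero (Finset.mem_erase.mpr ⟨h, Finset.mem_univ k⟩) (by simp), mul_zero]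

theorem famPolyDeriv_eq (v : Tangent g) : famPolyDeriv s.1 v = ∑ i, C (-v i) * famQuot s i := rfl

/-- The roots of `f_s` are `0`, `1` and the `s_i`. -/
theorem famPoly_isRoot_iff (a : ℂ) :
    (famPoly s.1).eval a = 0 ↔ a = 0 ∨ a = 1 ∨ ∃ i, a = s.1 i := by
  simp [famPoly, eval_prod, Finset.prod_eq_zero_iff, sub_eq_zero, or_assoc]

theorem famPoly_eval_s (i : Fin (2 * g - 1)) : (famPoly s.1).eval (s.1 i) = 0 :=
  (famPoly_isRoot_iff s _).mpr (Or.inr (Or.inr ⟨i, rfl⟩))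

/-- The roots of `f_s` are simple. -/
theorem exists_famPoly_eq_mul {a : ℂ} (ha : (famPoly s.1).eval a = 0) :
    ∃ q : ℂ[X], famPoly s.1 = (X - C a) * q ∧ q.eval a ≠ 0 := by
  rcases (famPoly_isRoot_iff s a).mp ha with rfl | rfl | ⟨i, rfl⟩
  · refine ⟨(X - 1) * ∏ i, (X - C (s.1 i)), by simp [famPoly]; ring, ?_⟩
    simp only [eval_mul, eval_X, eval_sub, eval_one, eval_prod, eval_C]
    refine mul_ne_zero (by norm_num) (Finset.prod_ne_zero_iff.mpr fun k _ => ?_)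
    simpa using (s.2.1 k).1
  · refine ⟨X * ∏ i, (X - C (s.1 i)), by simp [famPoly]; ring, ?_⟩
    simp only [eval_mul, eval_X, eval_sub, eval_prod, eval_C, one_mul]
    refine Finset.prod_ne_zero_iff.mpr fun k _ => ?_
    rw [sub_ne_zero]
    exact (s.2.1 k).2.symm
  · exact ⟨famQuot s i, famPoly_eq_mul_famQuot s i, famQuot_eval_self s i⟩

theorem famPoly_deriv_eval_ne_zero {a : ℂ} (ha : (famPoly s.1).eval a = 0) :
    (derivative (famPoly s.1)).eval a ≠ 0 := by
  obtain ⟨q, hq, h⟩ := exists_famPoly_eq_mul s ha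
  rw [hq]
  simpa using h

theorem famPoly_deriv_eval_s (i : Fin (2 * g - 1)) :
    (derivative (famPoly s.1)).eval (s.1 i) = (famQuot s i).eval (s.1 i) := by
  rw [famPoly_eq_mul_famQuot s i]
  simp

/-- Only the summand omitting the factor `x - s_i` survives at `s_i`. With
`famPolyDeriv_eval_zero_or_one`, this makes the root `s_i` move with velocity `v i` while `0` and
`1` stay fixed. -/
theorem famPolyDeriv_eval_s (v : Tangent g) (i : Fin (2 * g - 1)) :
    (famPolyDeriv s.1 v).eval (s.1 i) = -v i * (derivative (famPoly s.1)).eval (s.1 i) := by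
  rw [famPolyDeriv_eq, eval_finsetSum, Finset.sum_eq_single i, famPoly_deriv_eval_s]
  · simp
  · intro k _ hk
    rw [eval_mul, famQuot_eval_ne s hk.symm, mul_zero]
  · simp

theorem famPolyDeriv_eval_zero_or_one (v : Tangent g) {a : ℂ} (ha : a = 0 ∨ a = 1) :
    (famPolyDeriv s.1 v).eval a = 0 := by
  rw [famPolyDeriv_eq, eval_finsetSum]
  refine Finset.sum_eq_zero fun i _ => ?_
  rcases ha with rfl | rfl <;> simp [famQuot]

theorem famPoly_monic : (famPoly s.1).Monic := by
  unfold famPoly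
  exact (monic_X.mul (monic_X_sub_C 1)).mul (monic_prod_of_monic _ _ fun i _ => monic_X_sub_C _)

theorem famPoly_natDegree (hg : 1 ≤ g) : (famPoly s.1).natDegree = 2 * g + 1 := by
  have h1 : (X - 1 : ℂ[X]) = X - C 1 := by simp
  unfold famPoly
  rw [h1, (monic_X.mul (monic_X_sub_C 1)).natDegree_mul
    (monic_prod_of_monic _ _ fun i _ => monic_X_sub_C _), monic_X.natDegree_mul (monic_X_sub_C 1),
    natDegree_prod_of_monic _ _ fun i _ => monic_X_sub_C _]
  simp only [natDegree_X, natDegree_X_sub_C, Finset.sum_const, Finset.card_univ, Fintype.card_fin,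
    smul_eq_mul]
  omega

theorem famPoly_ne_zero : famPoly s.1 ≠ 0 := (famPoly_monic s).ne_zero

theorem famQuot_natDegree_le (hg : 1 ≤ g) (i : Fin (2 * g - 1)) :
    (famQuot s i).natDegree ≤ 2 * g := by
  have h := famPoly_natDegree s hg
  have h0 : famQuot s i ≠ 0 := by
    rintro h
    have := famQuot_eval_self s i
    simp [h] at this
  rw [famPoly_eq_mul_famQuot s i, natDegree_mul (X_sub_C_ne_zero _) h0, natDegree_X_sub_C] at h
  omega

theorem famPolyDeriv_natDegree_le (hg : 1 ≤ g) (v : Tangent g) :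
    (famPolyDeriv s.1 v).natDegree ≤ 2 * g := by
  rw [famPolyDeriv_eq]
  exact natDegree_sum_le_of_forall_le _ _ fun i _ =>
    (natDegree_C_mul_le _ _).trans (famQuot_natDegree_le s hg i)

end famPoly


/-! ### The function field -/

section FunField

variable {g : ℕ} (s : Base g)

/-- Rational functions of `x`, as functions on `Y_s`. -/
def ratFun : RatFunc ℂ →+* FunField s := algebraMap (RatFunc ℂ) (FunField s)

theorem ratFun_X : ratFun s RatFunc.X = xFun s := rfl

theorem ratFun_C (c : ℂ) : ratFun s (RatFunc.C c) = algebraMap ℂ (FunField s) c := rfl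

/-- Polynomials in `x`, as functions on `Y_s`. -/
def polyFun : ℂ[X] →+* FunField s := (ratFun s).comp (algebraMap ℂ[X] (RatFunc ℂ))

theorem polyFun_apply (p : ℂ[X]) : polyFun s p = ratFun s (algebraMap ℂ[X] (RatFunc ℂ) p) := rfl

theorem polyFun_X : polyFun s X = xFun s := by
  rw [polyFun_apply, RatFunc.algebraMap_X, ratFun_X]

theorem polyFun_C (c : ℂ) : polyFun s (C c) = algebraMap ℂ (FunField s) c := by
  rw [polyFun_apply, RatFunc.algebraMap_C, ratFun_C]

theorem polyFun_X_sub_C (a : ℂ) : polyFun s (X - C a) = ratFun s (linFrac a) := rfl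

theorem aeval_xFun (p : ℂ[X]) : aeval (xFun s) p = polyFun s p := by
  induction p using Polynomial.induction_on' with
  | add p q hp hq => rw [map_add, map_add, hp, hq]
  | monomial n a =>
    rw [aeval_monomial, ← C_mul_X_pow_eq_monomial, map_mul, map_pow, polyFun_X, polyFun_C]

theorem yFun_sq_eq : yFun s ^ 2 = polyFun s (famPoly s.1) := yFun_sq s

theorem polyFun_ne_zero {p : ℂ[X]} (hp : p ≠ 0) : polyFun s p ≠ 0 := by
  rw [polyFun_apply, Ne, map_eq_zero_iff _ (ratFun s).injective,
    map_eq_zero_iff _ (RatFunc.algebraMap_injective ℂ)]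
  exact hp

theorem xFun_ne_zero : xFun s ≠ 0 := by
  rw [← polyFun_X]; exact polyFun_ne_zero s X_ne_zero

theorem yFun_ne_zero : yFun s ≠ 0 := by
  intro h
  have h1 := yFun_sq_eq s
  rw [h, zero_pow two_ne_zero] at h1
  exact polyFun_ne_zero s (famPoly_ne_zero s) h1.symm

/-- Every function on `Y_s` is of the form `A(x) + B(x) y`. -/
theorem exists_eq_ratFun_add (h : FunField s) :
    ∃ A B : RatFunc ℂ, h = ratFun s A + ratFun s B * yFun s := by
  obtain ⟨p, rfl⟩ := AdjoinRoot.mk_surjective h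
  induction p using Polynomial.induction_on with
  | C a => exact ⟨a, 0, by simp [ratFun]⟩
  | add p q hp hq =>
    obtain ⟨A, B, h⟩ := hp
    obtain ⟨A', B', h'⟩ := hq
    exact ⟨A + A', B + B', by rw [map_add, h, h', map_add, map_add]; ring⟩
  | monomial n a h =>
    obtain ⟨A, B, h⟩ := h
    -- `(A + B y) y = B f + A y`.
    refine ⟨B * algebraMap ℂ[X] (RatFunc ℂ) (famPoly s.1), A, ?_⟩
    rw [pow_succ, ← mul_assoc, map_mul, h, AdjoinRoot.mk_X, map_mul, ← polyFun_apply,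
      ← yFun_sq_eq]
    change _ * yFun s = _
    ring

theorem hypInv_ratFun (A : RatFunc ℂ) : hypInv s (ratFun s A) = ratFun s A :=
  (hypInv s).commutes A

theorem hypInv_yFun : hypInv s (yFun s) = -yFun s := by
  unfold hypInv yFun
  exact AdjoinRoot.liftAlgHom_root _ _ _ _

end FunField

/-! ### Expansions with respect to local parameters -/

namespace LocalParam

variable {g : ℕ} {s : Base g} {P : Point s} (t : LocalParam P)

theorem dx_eq : t.dx = laurentDeriv (t.expand (xFun s)) := rfl

theorem expand_polyFun_C (c : ℂ) : t.expand (polyFun s (C c)) = HahnSeries.C c := by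
  rw [polyFun_C]; exact t.expand_const c

theorem expand_ratFun_C (c : ℂ) : t.expand (ratFun s (RatFunc.C c)) = HahnSeries.C c := by
  rw [ratFun_C]; exact t.expand_const c

theorem expand_ne_zero {h : FunField s} (hh : h ≠ 0) : t.expand h ≠ 0 :=
  (map_ne_zero_iff _ t.expand.injective).mpr hh

theorem expand_linFrac (a : ℂ) :
    t.expand (ratFun s (linFrac a)) = t.expand (xFun s) - HahnSeries.C a := by
  rw [linFrac_eq, map_sub, map_sub, ratFun_X, expand_ratFun_C]

/-- The chain rule for polynomials in `x`. -/
theorem laurentDeriv_expand_polyFun (p : ℂ[X]) :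
    laurentDeriv (t.expand (polyFun s p)) = t.expand (polyFun s (derivative p)) * t.dx := by
  induction p using Polynomial.induction_on with
  | C a => rw [expand_polyFun_C, laurentDeriv_C, derivative_C]; simp
  | add p q hp hq =>
    simp only [map_add, laurentDeriv_add, hp, hq, add_mul]
  | monomial n a h =>
    rw [pow_succ, ← mul_assoc, map_mul, map_mul, laurentDeriv_mul, h, polyFun_X,
      derivative_mul (f := C a * X ^ n), derivative_X, mul_one, map_add, map_add,
      map_mul _ _ X, map_mul _ _ (polyFun s X), polyFun_X, dx_eq]
    ring

theorem residue_add (h k : FunField s) : t.residue (h + k) = t.residue h + t.residue k := by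
  simp [residue, add_mul]

theorem residue_sub (h k : FunField s) : t.residue (h - k) = t.residue h - t.residue k := by
  simp [residue, sub_mul]

theorem residue_const_mul (c : ℂ) (h : FunField s) :
    t.residue (algebraMap ℂ (FunField s) c * h) = c * t.residue h := by
  rw [residue, map_mul, t.expand_const, mul_assoc, HahnSeries.C_mul_eq_smul,
    HahnSeries.coeff_smul, smul_eq_mul, residue]

theorem residue_neg (h : FunField s) : t.residue (-h) = -t.residue h := by
  simpa using t.residue_const_mul (-1) h

theorem residue_eq_zero {h : FunField s} (hh : OrderGE (t.expand h * t.dx) 0) :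
    t.residue h = 0 := hh.residue_eq_zero

/-- The orders of rational functions of `x` are multiples of a number that divides those of the
functions `x - a`. -/
theorem exists_hasOrder_ratFun {n : ℤ}
    (hlin : ∀ a, ∃ k : ℤ, HasOrder (t.expand (ratFun s (linFrac a))) (k * n))
    {A : RatFunc ℂ} (hA : A ≠ 0) : ∃ k : ℤ, HasOrder (t.expand (ratFun s A)) (k * n) := by
  refine ratFunc_mul_induction
    (p := fun A => ∃ k : ℤ, HasOrder (t.expand (ratFun s A)) (k * n)) ?_ hlin ?_ ?_ hA
  · intro c hc
    refine ⟨0, ?_⟩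
    rw [expand_ratFun_C, zero_mul]
    exact hasOrder_C hc
  · rintro A B ⟨k, hk⟩ ⟨l, hl⟩
    refine ⟨k + l, ?_⟩
    rw [map_mul, map_mul, add_mul]
    exact hk.mul hl
  · rintro A ⟨k, hk⟩
    refine ⟨-k, ?_⟩
    rw [map_inv₀, map_inv₀, neg_mul]
    exact hk.inv

/-- At a branch point, a function which is a square root of a rational function of `x` is a
uniformizer. -/
theorem eq_one_of_sqrt {w : FunField s} {m : ℤ} (hm : 0 < m) (hw : HasOrder (t.expand w) m)
    (hlin : ∀ a, ∃ k : ℤ, HasOrder (t.expand (ratFun s (linFrac a))) (k * (2 * m)))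
    (hdec : ∀ h : FunField s, ∃ A B : RatFunc ℂ, h = ratFun s A + ratFun s B * w) : m = 1 := by
  obtain ⟨h, hh⟩ := t.order_one
  have h0 : t.expand h ≠ 0 := by rintro h0; simp [h0] at hh
  have h1 : HasOrder (t.expand h) 1 := hasOrder_iff.mpr ⟨h0, hh⟩
  -- Orders of `A(x)` are even multiples of `m` and orders of `B(x) w` odd ones, so the two terms
  -- cannot cancel and every function has order divisible by `m`, including the one of order `1`.
  suffices hd : m ∣ 1 by exact Int.eq_one_of_dvd_one hm.le hd
  obtain ⟨A, B, rfl⟩ := hdec h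
  rw [map_add, map_mul] at h1
  rcases eq_or_ne A 0 with rfl | hA
  · rcases eq_or_ne B 0 with rfl | hB
    · simp at h1
      exact absurd rfl h1.ne_zero
    · obtain ⟨l, hl⟩ := t.exists_hasOrder_ratFun hlin hB
      rw [map_zero, map_zero, zero_add] at h1
      rw [h1.unique (hl.mul hw)]
      exact ⟨2 * l + 1, by ring⟩
  · obtain ⟨k, hk⟩ := t.exists_hasOrder_ratFun hlin hA
    rcases eq_or_ne B 0 with rfl | hB
    · rw [map_zero, map_zero, zero_mul, add_zero] at h1
      rw [h1.unique hk]
      exact ⟨2 * k, by ring⟩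
    · obtain ⟨l, hl⟩ := t.exists_hasOrder_ratFun hlin hB
      have hlw := hl.mul hw
      rcases lt_trichotomy (k * (2 * m)) (l * (2 * m) + m) with h | h | h
      · rw [h1.unique (hk.add_of_lt hlw.orderGE h)]
        exact ⟨2 * k, by ring⟩
      · exfalso
        have h2 : m * (2 * k) = m * (2 * l + 1) := by linear_combination h
        have h3 := mul_left_cancel₀ hm.ne' h2
        omega
      · rw [add_comm] at h1
        rw [h1.unique (hlw.add_of_lt hk.orderGE h)]
        exact ⟨2 * l + 1, by ring⟩

end LocalParam

/-! ### Affine points -/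

section Affine

variable {g : ℕ} {s : Base g} {a b : ℂ} {hab : b ^ 2 = (famPoly s.1).eval a}
  (t : LocalParam (Point.affine a b hab))

theorem orderGE_expand_xFun : OrderGE (t.expand (xFun s)) 0 := noPole_iff.mp t.noPole_one

theorem orderGE_expand_yFun : OrderGE (t.expand (yFun s)) 0 := noPole_iff.mp t.noPole_two

theorem orderGE_expand_linFrac : OrderGE (t.expand (ratFun s (linFrac a))) 1 := by
  rw [t.expand_linFrac]
  refine ((orderGE_expand_xFun t).sub (orderGE_C a)).succ ?_
  have : (t.expand (xFun s)).coeff 0 = a := t.value_one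
  simp [this]

theorem orderGE_expand_yFun_sub : OrderGE (t.expand (yFun s) - HahnSeries.C b) 1 := by
  refine ((orderGE_expand_yFun t).sub (orderGE_C b)).succ ?_
  have : (t.expand (yFun s)).coeff 0 = b := t.value_two
  simp [this]

theorem orderGE_expand_polyFun (p : ℂ[X]) : OrderGE (t.expand (polyFun s p)) 0 := by
  induction p using Polynomial.induction_on with
  | C a => rw [t.expand_polyFun_C]; exact orderGE_C a
  | add p q hp hq => rw [map_add, map_add]; exact hp.add hq
  | monomial n a h =>
    rw [pow_succ, ← mul_assoc, map_mul, map_mul, polyFun_X]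
    exact h.mul (orderGE_expand_xFun t)

theorem orderGE_expand_polyFun_of_root {p : ℂ[X]} (hp : p.eval a = 0) :
    OrderGE (t.expand (polyFun s p)) 1 := by
  obtain ⟨q, rfl⟩ := dvd_iff_isRoot.mpr hp
  rw [map_mul, map_mul, polyFun_X_sub_C]
  exact (orderGE_expand_linFrac t).mul (orderGE_expand_polyFun t q)

theorem hasOrder_expand_polyFun {p : ℂ[X]} (hp : p.eval a ≠ 0) :
    HasOrder (t.expand (polyFun s p)) 0 := by
  have h1 : OrderGE (t.expand (polyFun s (p - C (p.eval a)))) 1 :=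
    orderGE_expand_polyFun_of_root t (by simp)
  have h2 := (hasOrder_C hp).add_of_lt h1 zero_lt_one
  rwa [map_sub, map_sub, t.expand_polyFun_C, add_sub_cancel] at h2

theorem hasOrder_expand_linFrac_of_ne {c : ℂ} (hc : c ≠ a) :
    HasOrder (t.expand (ratFun s (linFrac c))) 0 := by
  rw [← polyFun_X_sub_C]
  exact hasOrder_expand_polyFun t (by simpa [sub_eq_zero] using hc.symm)

theorem exists_hasOrder_expand_linFrac :
    ∃ n : ℤ, 0 < n ∧ HasOrder (t.expand (ratFun s (linFrac a))) n := by
  obtain ⟨n, hn⟩ := exists_hasOrder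
    (t.expand_ne_zero ((map_ne_zero_iff _ (ratFun s).injective).mpr (linFrac_ne_zero a)))
  exact ⟨n, hn.le (orderGE_expand_linFrac t), hn⟩

theorem orderGE_dx : OrderGE t.dx 0 := (orderGE_expand_xFun t).laurentDeriv_of_zero

/-- Away from the branch points, `y` is a power series in `x - a`. -/
theorem exists_sqrt_mod (a b : ℂ) (hb : b ≠ 0) (f : ℂ[X]) (h : b ^ 2 = f.eval a) (N : ℕ) :
    ∃ p : ℂ[X], p.eval a = b ∧ (X - C a) ^ N ∣ f - p ^ 2 := by
  induction N with
  | zero => exact ⟨C b, by simp, by simp⟩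
  | succ N ih =>
    -- The Newton correction below has square divisible by `(x - a)^(2N)`, which is enough only when
    -- `N ≥ 1`.
    rcases Nat.eq_zero_or_pos N with rfl | hN
    · refine ⟨C b, by simp, ?_⟩
      rw [zero_add, pow_one, dvd_iff_isRoot]
      simp [h]
    · obtain ⟨p, hp, r, hr⟩ := ih
      -- With `f - p² = (x - a)^N r`, adding `c (x - a)^N` to `p` changes `r` to `r - 2 c p` modulo
      -- `x - a`; as `p(a) = b`, it vanishes at `a` for `c = r(a) / (2b)`.
      refine ⟨p + C (r.eval a / (2 * b)) * (X - C a) ^ N, by simp [hp, hN.ne'], ?_⟩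
      obtain ⟨M, rfl⟩ := Nat.exists_eq_add_of_lt hN
      have h1 : (X - C a) ∣ r - C 2 * C (r.eval a / (2 * b)) * p := by
        rw [dvd_iff_isRoot, IsRoot.def]
        simp only [eval_sub, eval_mul, eval_C, hp]
        field_simp
        ring
      obtain ⟨q, hq⟩ := h1
      refine ⟨q - C (r.eval a / (2 * b)) ^ 2 * (X - C a) ^ (0 + M), ?_⟩
      have h2 : (C 2 : ℂ[X]) = 2 := map_ofNat C 2
      rw [h2] at hq
      linear_combination hr + (X - C a) ^ (0 + M + 1) * hq

/-- In `(y - p)(y + p) = f - p²` the factor `y + p` takes the value `2b ≠ 0`, so all the vanishing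
falls on `y - p`. -/
theorem orderGE_expand_yFun_sub_polyFun (hb : b ≠ 0) {N : ℕ} {p : ℂ[X]} (hp : p.eval a = b)
    (h : (X - C a) ^ N ∣ famPoly s.1 - p ^ 2) :
    OrderGE (t.expand (yFun s - polyFun s p)) N := by
  have h1 : HasOrder (t.expand (yFun s + polyFun s p)) 0 := by
    have h2 : OrderGE (t.expand (polyFun s (p - C b))) 1 :=
      orderGE_expand_polyFun_of_root t (by simp [hp])
    have h3 := (hasOrder_C (show 2 * b ≠ 0 by simpa using hb)).add_of_lt
      ((orderGE_expand_yFun_sub t).add h2) zero_lt_one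
    convert h3 using 1
    rw [map_sub, map_sub, t.expand_polyFun_C, map_add, two_mul, map_add]
    ring
  obtain ⟨r, hr⟩ := h
  have h4 : (yFun s - polyFun s p) * (yFun s + polyFun s p) =
      ratFun s (linFrac a) ^ N * polyFun s r := by
    rw [← polyFun_X_sub_C, ← map_pow, ← map_mul, ← hr, map_sub, ← yFun_sq_eq, map_pow]
    ring
  have h5 : t.expand (yFun s - polyFun s p) =
      t.expand (ratFun s (linFrac a)) ^ N * t.expand (polyFun s r) /
        t.expand (yFun s + polyFun s p) := by
    rw [eq_div_iff h1.ne_zero, ← map_mul, h4, map_mul, map_pow]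
  obtain ⟨n, hn, hn'⟩ := exists_hasOrder_expand_linFrac t
  rw [h5]
  refine (((hn'.pow N).orderGE.mul (orderGE_expand_polyFun t r)).div h1).mono ?_
  nlinarith [Int.natCast_nonneg N]

/-- Away from the branch points, `x - a` is a uniformizer. -/
theorem hasOrder_expand_linFrac (hb : b ≠ 0) :
    HasOrder (t.expand (ratFun s (linFrac a))) 1 := by
  obtain ⟨n, hn, hn'⟩ := exists_hasOrder_expand_linFrac t
  suffices hd : n ∣ 1 by rwa [← Int.eq_one_of_dvd_one hn.le hd]
  have hlin : ∀ c, ∃ k : ℤ, HasOrder (t.expand (ratFun s (linFrac c))) (k * n) := by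
    intro c
    rcases eq_or_ne c a with rfl | hc
    · exact ⟨1, by rwa [one_mul]⟩
    · exact ⟨0, by rw [zero_mul]; exact hasOrder_expand_linFrac_of_ne t hc⟩
  obtain ⟨h, hh⟩ := t.order_one
  have h0 : t.expand h ≠ 0 := by rintro h0; simp [h0] at hh
  have h1 : HasOrder (t.expand h) 1 := hasOrder_iff.mpr ⟨h0, hh⟩
  obtain ⟨A, B, rfl⟩ := exists_eq_ratFun_add s h
  -- `N` is large enough that replacing `y` by its approximation `p(x)` changes `A + B y` only from
  -- order `2` on. The rational function `A + B p` of `x` then still has order `1`, while its order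
  -- is a multiple of `n`.
  obtain ⟨N, hN⟩ : ∃ N : ℕ, OrderGE (t.expand (ratFun s B)) (2 - N) := by
    rcases eq_or_ne B 0 with rfl | hB
    · exact ⟨0, by rw [map_zero, map_zero]; exact orderGE_zero _⟩
    · obtain ⟨k, hk⟩ := t.exists_hasOrder_ratFun hlin hB
      exact ⟨(2 - k * n).toNat, hk.orderGE.mono (by omega)⟩
  obtain ⟨p, hp, hp'⟩ := exists_sqrt_mod a b hb _ hab N
  have h2 := hN.mul (orderGE_expand_yFun_sub_polyFun t hb hp hp')
  rw [sub_add_cancel] at h2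
  have h3 := h1.add_of_lt h2.neg (by norm_num)
  have h4 : t.expand (ratFun s (A + B * algebraMap ℂ[X] (RatFunc ℂ) p)) =
      t.expand (ratFun s A + ratFun s B * yFun s) +
        -(t.expand (ratFun s B) * t.expand (yFun s - polyFun s p)) := by
    rw [map_add (ratFun s), map_mul (ratFun s), ← polyFun_apply, ← map_mul, ← map_neg, ← map_add]
    congr 1; ring
  rw [← h4] at h3
  have h5 : A + B * algebraMap ℂ[X] (RatFunc ℂ) p ≠ 0 := by
    intro h5
    rw [h5, map_zero, map_zero] at h3
    exact h3.ne_zero rfl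
  obtain ⟨k, hk⟩ := t.exists_hasOrder_ratFun hlin h5
  rw [h3.unique hk]
  exact ⟨k, by ring⟩

theorem hasOrder_dx (hb : b ≠ 0) : HasOrder t.dx 0 := by
  have h := (hasOrder_expand_linFrac t hb).laurentDeriv one_ne_zero
  rwa [t.expand_linFrac, laurentDeriv_sub, laurentDeriv_C, sub_zero] at h

theorem hasOrder_expand_yFun_of_ne (hb : b ≠ 0) : HasOrder (t.expand (yFun s)) 0 := by
  have h := (hasOrder_C hb).add_of_lt (orderGE_expand_yFun_sub t) zero_lt_one
  rwa [add_sub_cancel] at h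

/-- At the affine branch points, `y` is a uniformizer and `x - a` has order two. -/
theorem hasOrder_branch (hb : b = 0) :
    HasOrder (t.expand (yFun s)) 1 ∧ HasOrder (t.expand (ratFun s (linFrac a))) 2 := by
  obtain ⟨n, hn, hn'⟩ := exists_hasOrder_expand_linFrac t
  obtain ⟨m, hm⟩ := exists_hasOrder (t.expand_ne_zero (yFun_ne_zero s))
  have hroot : (famPoly s.1).eval a = 0 := by rw [← hab, hb]; ring
  obtain ⟨q, hq, hqa⟩ := exists_famPoly_eq_mul s hroot
  -- Compare orders in `y² = (x - a) q(x)`, where `q(a) ≠ 0` because the root is simple.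
  have h1 : n = 2 * m := by
    have h2 := (hn'.mul (hasOrder_expand_polyFun t hqa))
    rw [← polyFun_X_sub_C, ← map_mul, ← map_mul, ← hq, ← yFun_sq_eq, map_pow] at h2
    have := h2.unique (hm.pow 2)
    push_cast at this
    omega
  have hm1 : m = 1 := by
    refine t.eq_one_of_sqrt (by omega) hm ?_ (exists_eq_ratFun_add s)
    intro c
    rcases eq_or_ne c a with rfl | hc
    · exact ⟨1, by rwa [one_mul, ← h1]⟩
    · exact ⟨0, by rw [zero_mul]; exact hasOrder_expand_linFrac_of_ne t hc⟩
  subst hm1 h1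
  exact ⟨hm, hn'⟩

theorem hasOrder_dx_branch (hb : b = 0) : HasOrder t.dx 1 := by
  have h := (hasOrder_branch t hb).2.laurentDeriv two_ne_zero
  rwa [t.expand_linFrac, laurentDeriv_sub, laurentDeriv_C, sub_zero] at h

end Affine

/-! ### The point at infinity -/

section Infinity

variable {g : ℕ} {s : Base g} (t : LocalParam (Point.infinity : Point s))

/-- The pole order `n` of `x` stays unknown in the two auxiliary lemmas that follow;
`hasOrder_infinity` uses them to show `n = 2`. -/
theorem exists_hasOrder_expand_xFun_infinity :
    ∃ n : ℤ, 0 < n ∧ HasOrder (t.expand (xFun s)) (-n) := by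
  obtain ⟨n, hn⟩ := exists_hasOrder (t.expand_ne_zero (inv_ne_zero (xFun_ne_zero s)))
  have h1 : OrderGE (t.expand (xFun s)⁻¹) 1 := (noPole_iff.mp t.noPole_one).succ t.value_one
  refine ⟨n, hn.le h1, ?_⟩
  have := hn.inv
  rwa [map_inv₀, inv_inv] at this

theorem hasOrder_expand_linFrac_infinity_aux {n : ℤ} (hn : 0 < n)
    (h : HasOrder (t.expand (xFun s)) (-n)) (a : ℂ) :
    HasOrder (t.expand (ratFun s (linFrac a))) (-n) := by
  rw [t.expand_linFrac, sub_eq_add_neg]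
  exact h.add_of_lt (orderGE_C a).neg (by omega)

theorem hasOrder_expand_polyFun_infinity_aux {n : ℤ} (hn : 0 < n)
    (h : HasOrder (t.expand (xFun s)) (-n)) {p : ℂ[X]} (hp : p ≠ 0) :
    HasOrder (t.expand (polyFun s p)) (-(n * p.natDegree)) := by
  have key : ∀ m : Multiset ℂ,
      HasOrder (t.expand (polyFun s (m.map fun a => X - C a).prod)) (-(n * m.card)) := by
    intro m
    induction m using Multiset.induction with
    | empty => simpa using hasOrder_one
    | cons a m ih =>
      rw [Multiset.map_cons, Multiset.prod_cons, map_mul, map_mul, polyFun_X_sub_C]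
      convert (hasOrder_expand_linFrac_infinity_aux t hn h a).mul ih using 1
      rw [Multiset.card_cons]; push_cast; ring
  have h1 := (hasOrder_C (leadingCoeff_ne_zero.mpr hp)).mul (key p.roots)
  rw [← t.expand_polyFun_C, ← map_mul, ← map_mul, ← (IsAlgClosed.splits p).eq_prod_roots,
    zero_add, ← (IsAlgClosed.splits p).natDegree_eq_card_roots] at h1
  exact h1

/-- From `y² = f` one gets `2 ord y = -n (2g + 1)`, so `v = y / x^(g+1)` has order `n / 2`. Every
function is `A(x) + B(x) v`, so `eq_one_of_sqrt` applies to `v` and gives `n / 2 = 1`. -/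
theorem hasOrder_infinity (hg : 1 ≤ g) :
    HasOrder (t.expand (xFun s)) (-2) ∧ HasOrder (t.expand (yFun s)) (-(2 * g + 1)) ∧
      HasOrder (t.expand (yFun s / xFun s ^ (g + 1))) 1 := by
  obtain ⟨n, hn, hn'⟩ := exists_hasOrder_expand_xFun_infinity t
  obtain ⟨k, hk⟩ := exists_hasOrder (t.expand_ne_zero (yFun_ne_zero s))
  have h1 := hasOrder_expand_polyFun_infinity_aux t hn hn' (famPoly_ne_zero s)
  rw [← yFun_sq_eq, map_pow, famPoly_natDegree s hg] at h1
  have h2 := h1.unique (hk.pow 2)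
  push_cast at h2
  have hw : HasOrder (t.expand (yFun s / xFun s ^ (g + 1))) (k + n * (g + 1)) := by
    rw [map_div₀, map_pow]
    convert hk.div (hn'.pow (g + 1)) using 1
    push_cast; ring
  have h3 : n = 2 * (k + n * (g + 1)) := by linarith
  have hm1 : k + n * (g + 1) = 1 := by
    refine t.eq_one_of_sqrt (by omega) hw ?_ ?_
    · intro c
      refine ⟨-1, ?_⟩
      rw [← h3, neg_one_mul]
      exact hasOrder_expand_linFrac_infinity_aux t hn hn' c
    · intro h
      obtain ⟨A, B, rfl⟩ := exists_eq_ratFun_add s h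
      refine ⟨A, B * RatFunc.X ^ (g + 1), ?_⟩
      rw [map_mul, map_pow, ratFun_X, mul_assoc, mul_div_cancel₀]
      exact pow_ne_zero _ (xFun_ne_zero s)
  rw [hm1] at hw h3
  obtain rfl : n = 2 := by omega
  refine ⟨hn', ?_, hw⟩
  rwa [show -(2 * (g : ℤ) + 1) = k by linarith]

theorem hasOrder_expand_polyFun_infinity (hg : 1 ≤ g) {p : ℂ[X]} (hp : p ≠ 0) :
    HasOrder (t.expand (polyFun s p)) (-(2 * p.natDegree)) :=
  hasOrder_expand_polyFun_infinity_aux t two_pos (hasOrder_infinity t hg).1 hp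

theorem orderGE_expand_polyFun_infinity (hg : 1 ≤ g) {p : ℂ[X]} {d : ℕ} (hp : p.natDegree ≤ d) :
    OrderGE (t.expand (polyFun s p)) (-(2 * d)) := by
  rcases eq_or_ne p 0 with rfl | h
  · rw [map_zero, map_zero]; exact orderGE_zero _
  · exact (hasOrder_expand_polyFun_infinity t hg h).orderGE.mono (by omega)

theorem hasOrder_expand_linFrac_infinity (hg : 1 ≤ g) (a : ℂ) :
    HasOrder (t.expand (ratFun s (linFrac a))) (-2) :=
  hasOrder_expand_linFrac_infinity_aux t two_pos (hasOrder_infinity t hg).1 a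

theorem hasOrder_dx_infinity (hg : 1 ≤ g) : HasOrder t.dx (-3) :=
  (hasOrder_infinity t hg).1.laurentDeriv (by norm_num)

end Infinity


/-! ### Residues -/

namespace LocalParam

variable {g : ℕ} {s : Base g} {P : Point s} (t : LocalParam P)

theorem dx_eq_deriv_linFrac (a : ℂ) :
    t.dx = laurentDeriv (t.expand (ratFun s (linFrac a))) := by
  rw [t.expand_linFrac, laurentDeriv_sub, laurentDeriv_C, sub_zero, dx_eq]

theorem expand_ratFun_ne_zero {A : RatFunc ℂ} (hA : A ≠ 0) : t.expand (ratFun s A) ≠ 0 :=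
  t.expand_ne_zero ((map_ne_zero_iff _ (ratFun s).injective).mpr hA)

theorem residue_xFun_pow (n : ℕ) : t.residue (ratFun s (RatFunc.X ^ n)) = 0 := by
  have h := residue_zpow_mul_deriv (t.expand_ne_zero (xFun_ne_zero s)) (n := n) (by omega)
  rwa [zpow_natCast, ← map_pow, ← ratFun_X, ← map_pow] at h

theorem residue_linFrac_zpow (a : ℂ) {n : ℤ} (hn : n ≠ -1) :
    t.residue (ratFun s (linFrac a ^ n)) = 0 := by
  rw [residue, t.dx_eq_deriv_linFrac a, map_zpow₀, map_zpow₀]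
  exact residue_zpow_mul_deriv (t.expand_ratFun_ne_zero (linFrac_ne_zero a)) hn

theorem residue_linFrac_inv {a : ℂ} {n : ℤ}
    (h : HasOrder (t.expand (ratFun s (linFrac a))) n) :
    t.residue (ratFun s (linFrac a ^ (-1 : ℤ))) = n := by
  rw [residue, t.dx_eq_deriv_linFrac a, zpow_neg_one, map_inv₀, map_inv₀]
  exact h.residue_logDeriv

/-- The residue of `A(x) dx` is determined by the orders of the functions `x - a`. -/
theorem residue_ratFun_congr {P' : Point s} (t' : LocalParam P')
    (h : ∀ a, ∃ n, HasOrder (t.expand (ratFun s (linFrac a))) n ∧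
      HasOrder (t'.expand (ratFun s (linFrac a))) n) (A : RatFunc ℂ) :
    t.residue (ratFun s A) = t'.residue (ratFun s A) := by
  -- Only the terms `dx / (x - a)` have a residue, and it is the order of `x - a`; the other terms
  -- are exact.
  induction A using ratFunc_partialFraction_induction with
  | add A B hA hB => rw [map_add, residue_add, residue_add, hA, hB]
  | smul c A hA =>
    rw [map_mul, ratFun_C, residue_const_mul, residue_const_mul, hA]
  | X_pow n => rw [residue_xFun_pow, residue_xFun_pow]
  | lin a n =>
    rcases Nat.eq_zero_or_pos n with rfl | hn
    · obtain ⟨k, h1, h2⟩ := h a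
      have h3 := t.residue_linFrac_inv h1
      have h4 := t'.residue_linFrac_inv h2
      simp only [Nat.cast_zero, zero_add]
      rw [h3, h4]
    · rw [residue_linFrac_zpow _ _ (by omega), residue_linFrac_zpow _ _ (by omega)]

/-- If `w` is a uniformizer and its square is a rational function of `x`, then the residues of the
forms `B(x) w dx` vanish. -/
theorem residue_ratFun_mul_sqrt {w : FunField s} {F G H : RatFunc ℂ}
    (hw : HasOrder (t.expand w) 1) (hF : w ^ 2 = ratFun s F) (hH : H ≠ 0)
    (hG : t.expand (ratFun s G) * t.dx =
      t.expand (ratFun s H) * (t.expand w * laurentDeriv (t.expand w)))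
    (hlin : ∀ a, ∃ k : ℤ, HasOrder (t.expand (ratFun s (linFrac a))) (k * 2)) (B : RatFunc ℂ) :
    t.residue (ratFun s B * w) = 0 := by
  have hdw := hw.laurentDeriv one_ne_zero
  have hG0 : t.expand (ratFun s G) ≠ 0 := by
    intro h
    rw [h, zero_mul] at hG
    exact mul_ne_zero (t.expand_ratFun_ne_zero hH) (mul_ne_zero hw.ne_zero hdw.ne_zero) hG.symm
  have hF0 : t.expand (ratFun s F) = t.expand w ^ 2 := by rw [← hF, map_pow]
  -- A rational function of `x` behaves like an even series in `w`: its leading polar term is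
  -- removed by a multiple of `F^(-(k+1)) = w^(-2(k+1))`, and `w^(-2(k+1)) dw` has no residue.
  have key : ∀ (k : ℕ) (A : RatFunc ℂ), OrderGE (t.expand (ratFun s A)) (-(2 * k)) →
      (t.expand (ratFun s A) * laurentDeriv (t.expand w)).coeff (-1) = 0 := by
    intro k
    induction k with
    | zero =>
      intro A hA
      have h1 := hA.mul hdw.orderGE
      exact (h1.mono (by simp)).residue_eq_zero
    | succ k ih =>
      intro A hA
      set c := (t.expand (ratFun s A)).coeff (-(2 * (k + 1 : ℕ))) with hc
      have hz : HasOrder (t.expand (ratFun s (F ^ (-(k + 1 : ℤ))))) (-(2 * (k + 1 : ℕ))) := by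
        rw [map_zpow₀, map_zpow₀, hF0]
        convert (hw.pow 2).zpow _ using 1
        push_cast; ring
      set d := (t.expand (ratFun s (F ^ (-(k + 1 : ℤ))))).coeff (-(2 * (k + 1 : ℕ))) with hd
      have hd0 : d ≠ 0 := hz.coeff_ne_zero
      have hsplit : t.expand (ratFun s (A - RatFunc.C (c / d) * F ^ (-(k + 1 : ℤ)))) =
          t.expand (ratFun s A) -
            HahnSeries.C (c / d) * t.expand (ratFun s (F ^ (-(k + 1 : ℤ)))) := by
        rw [map_sub (ratFun s), map_sub, map_mul (ratFun s), map_mul, expand_ratFun_C]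
      have h1 : OrderGE (t.expand (ratFun s (A - RatFunc.C (c / d) * F ^ (-(k + 1 : ℤ)))))
          (-(2 * (k + 1 : ℕ)) + 1) := by
        rw [hsplit]
        refine (hA.sub (by simpa using (orderGE_C _).mul hz.orderGE)).succ ?_
        rw [HahnSeries.coeff_sub, HahnSeries.C_mul_eq_smul, HahnSeries.coeff_smul, ← hc, ← hd,
          smul_eq_mul, div_mul_cancel₀ _ hd0, sub_self]
      -- The subtraction gains one order; evenness of the orders gains the second.
      have h2 : OrderGE (t.expand (ratFun s (A - RatFunc.C (c / d) * F ^ (-(k + 1 : ℤ)))))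
          (-(2 * k)) := by
        rcases eq_or_ne (A - RatFunc.C (c / d) * F ^ (-(k + 1 : ℤ))) 0 with h | h
        · rw [h, map_zero, map_zero]; exact orderGE_zero _
        · obtain ⟨l, hl⟩ := t.exists_hasOrder_ratFun hlin h
          have := hl.le h1
          exact hl.orderGE.mono (by push_cast at this; omega)
      have h3 := ih _ h2
      have h4 : (t.expand (ratFun s (F ^ (-(k + 1 : ℤ)))) *
          laurentDeriv (t.expand w)).coeff (-1) = 0 := by
        have h5 : t.expand (ratFun s (F ^ (-(k + 1 : ℤ)))) = t.expand w ^ (2 * -(k + 1 : ℤ)) := by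
          rw [map_zpow₀, map_zpow₀, hF0, zpow_mul]
          norm_cast
        rw [h5]
        exact residue_zpow_mul_deriv hw.ne_zero (by omega)
      rw [hsplit, sub_mul, HahnSeries.coeff_sub, mul_assoc, HahnSeries.C_mul_eq_smul,
        HahnSeries.coeff_smul, h4, smul_zero, sub_zero] at h3
      exact h3
  -- `G dx = H w dw` and `w² = F` turn `B w dx` into `(B F H / G) dw`, to which `key` applies.
  have h1 : t.expand (ratFun s B * w) * t.dx =
      t.expand (ratFun s (B * F * H / G)) * laurentDeriv (t.expand w) := by
    rw [map_div₀ (ratFun s), map_div₀, div_mul_eq_mul_div, eq_div_iff hG0, mul_assoc, mul_comm t.dx,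
      hG, map_mul (ratFun s), map_mul (ratFun s), map_mul, map_mul, map_mul, hF0]
    ring
  rw [residue, h1]
  rcases eq_or_ne (B * F * H / G) 0 with h | h
  · rw [h, map_zero, map_zero, zero_mul, HahnSeries.coeff_zero]
  · obtain ⟨l, hl⟩ := t.exists_hasOrder_ratFun hlin h
    exact key (-l).toNat _ (hl.orderGE.mono (by omega))

end LocalParam

section Affine

variable {g : ℕ} {s : Base g} {a b : ℂ} {hab : b ^ 2 = (famPoly s.1).eval a}

/-- The uniformizer is `y` itself, and `y² = f` differentiates to `f' dx = 2 y dy`. -/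
theorem residue_ratFun_mul_yFun_branch (t : LocalParam (Point.affine a b hab)) (hb : b = 0)
    (B : RatFunc ℂ) : t.residue (ratFun s B * yFun s) = 0 := by
  obtain ⟨hy, hx⟩ := hasOrder_branch t hb
  refine t.residue_ratFun_mul_sqrt (G := algebraMap ℂ[X] (RatFunc ℂ) (derivative (famPoly s.1)))
    (H := RatFunc.C 2) hy (yFun_sq_eq s) ?_ ?_ ?_ B
  · exact (map_ne_zero_iff _ RatFunc.C_injective).mpr two_ne_zero
  · rw [← polyFun_apply, ← t.laurentDeriv_expand_polyFun, ← yFun_sq_eq, map_pow, t.expand_ratFun_C,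
      pow_two, laurentDeriv_mul, map_ofNat]
    ring
  · intro c
    rcases eq_or_ne c a with rfl | hc
    · exact ⟨1, by simpa using hx⟩
    · exact ⟨0, by simpa using hasOrder_expand_linFrac_of_ne t hc⟩

/-- Up to a regular form, `y` may be replaced by a polynomial `p(x)` at `(a, b)` and by `-p(x)` at
`(a, -b)`. Since `x - a` is a uniformizer at both points, `B p dx` has the same residue at both. -/
theorem residue_ratFun_mul_yFun_conj (t : LocalParam (Point.affine a b hab)) (hb : b ≠ 0)
    {hab' : (-b) ^ 2 = (famPoly s.1).eval a} (t' : LocalParam (Point.affine a (-b) hab'))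
    (B : RatFunc ℂ) :
    t'.residue (ratFun s B * yFun s) = -t.residue (ratFun s B * yFun s) := by
  have hb' : -b ≠ 0 := neg_ne_zero.mpr hb
  obtain ⟨N, h1, h2⟩ : ∃ N : ℕ, OrderGE (t.expand (ratFun s B)) (-N) ∧
      OrderGE (t'.expand (ratFun s B)) (-N) := by
    rcases eq_or_ne B 0 with rfl | hB
    · refine ⟨0, ?_, ?_⟩ <;> rw [map_zero, map_zero] <;> exact orderGE_zero _
    · obtain ⟨k, hk⟩ := exists_hasOrder (t.expand_ratFun_ne_zero hB)
      obtain ⟨l, hl⟩ := exists_hasOrder (t'.expand_ratFun_ne_zero hB)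
      exact ⟨(-k).toNat + (-l).toNat, hk.orderGE.mono (by omega), hl.orderGE.mono (by omega)⟩
  obtain ⟨p, hp, hdvd⟩ := exists_sqrt_mod a b hb _ hab N
  have key : ∀ {b' : ℂ} {h' : b' ^ 2 = (famPoly s.1).eval a}
      (u : LocalParam (Point.affine a b' h')) (_ : b' ≠ 0) (q : ℂ[X]) (_ : q.eval a = b')
      (_ : (X - C a) ^ N ∣ famPoly s.1 - q ^ 2) (_ : OrderGE (u.expand (ratFun s B)) (-N)),
      u.residue (ratFun s B * yFun s) =
        u.residue (ratFun s (B * algebraMap ℂ[X] (RatFunc ℂ) q)) := by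
    intro b' h' u hb' q hq hd hu
    rw [← sub_eq_zero, ← u.residue_sub, map_mul, ← polyFun_apply, ← mul_sub]
    apply u.residue_eq_zero
    rw [map_mul]
    exact ((hu.mul (orderGE_expand_yFun_sub_polyFun u hb' hq hd)).mul (orderGE_dx u)).mono
      (by simp)
  rw [key t hb p hp hdvd h1, key t' hb' (-p) (by simp [hp]) (by rwa [neg_sq]) h2, map_neg, mul_neg,
    map_neg, t'.residue_neg, t'.residue_ratFun_congr t]
  intro c
  rcases eq_or_ne c a with rfl | hc
  · exact ⟨1, hasOrder_expand_linFrac t' hb', hasOrder_expand_linFrac t hb⟩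
  · exact ⟨0, hasOrder_expand_linFrac_of_ne t' hc, hasOrder_expand_linFrac_of_ne t hc⟩

end Affine

/-! ### The residue theorem on `Y_s`. -/

section Global

variable {g : ℕ} {s : Base g}

theorem residue_ratFun_mul_yFun_infinity (hg : 1 ≤ g) (t : LocalParam (Point.infinity : Point s))
    (B : RatFunc ℂ) : t.residue (ratFun s B * yFun s) = 0 := by
  obtain ⟨hx, -, hw⟩ := hasOrder_infinity t hg
  have hx0 := xFun_ne_zero s
  set w := yFun s / xFun s ^ (g + 1) with hwdef
  have hyw : yFun s = xFun s ^ (g + 1) * w := by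
    rw [hwdef, mul_div_cancel₀]
    exact pow_ne_zero _ hx0
  have h0 : (RatFunc.X : RatFunc ℂ) ≠ 0 := RatFunc.X_ne_zero
  have hf := yFun_sq_eq s
  have hF : w ^ 2 = ratFun s (algebraMap ℂ[X] (RatFunc ℂ) (famPoly s.1) /
      RatFunc.X ^ (2 * (g + 1))) := by
    rw [map_div₀, map_pow, ← polyFun_apply, ← hf, ratFun_X, hwdef, div_pow, ← pow_mul, mul_comm 2]
  -- `G` and `H` come from differentiating `f = x^(2g+2) w²`: `f' dx = (2g+2) x^(2g+1) w² dx + 2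
  -- x^(2g+2) w dw`.
  have h1 := t.residue_ratFun_mul_sqrt hw hF
    (G := algebraMap ℂ[X] (RatFunc ℂ) (derivative (famPoly s.1)) -
      RatFunc.C (((2 * g + 1 : ℕ) : ℂ) + 1) * (RatFunc.X ^ (2 * g + 1) *
        (algebraMap ℂ[X] (RatFunc ℂ) (famPoly s.1) / RatFunc.X ^ (2 * (g + 1)))))
    (H := RatFunc.C 2 * RatFunc.X ^ (2 * (g + 1)))
    (mul_ne_zero ((map_ne_zero_iff _ RatFunc.C_injective).mpr two_ne_zero) (pow_ne_zero _ h0))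
    ?_ ?_ (B * RatFunc.X ^ (g + 1))
  · rw [hyw, ← mul_assoc]
    rwa [map_mul, map_pow, ratFun_X] at h1
  · rw [map_sub, map_mul (ratFun s), map_mul (ratFun s), ← hF, map_sub, map_mul, map_mul,
      t.expand_ratFun_C, ← polyFun_apply, sub_mul, ← t.laurentDeriv_expand_polyFun, ← hf, hyw,
      map_mul (ratFun s), map_mul, t.expand_ratFun_C, map_pow (ratFun s), map_pow (ratFun s),
      ratFun_X]
    have h2 := laurentDeriv_pow (t.expand (xFun s)) (2 * g + 1)
    rw [← t.dx_eq] at h2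
    simp only [map_pow, map_mul, map_ofNat]
    rw [show (t.expand (xFun s) ^ (g + 1) * t.expand w) ^ 2 =
      t.expand (xFun s) ^ (2 * g + 1 + 1) * (t.expand w * t.expand w) by ring,
      laurentDeriv_mul, h2, laurentDeriv_mul]
    ring
  · exact fun c => ⟨-1, by simpa using hasOrder_expand_linFrac_infinity t hg c⟩

/-- The hyperelliptic involution on the points of `Y_s`. -/
def Point.conj : Point s → Point s
  | .affine a b h => .affine a (-b) (by rwa [neg_sq])
  | .infinity => .infinity

theorem Point.conj_conj (P : Point s) : P.conj.conj = P := by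
  cases P <;> simp [Point.conj]

/-- At the fixed points of the involution, which are the branch points and infinity, both sides
vanish. -/
theorem residue_conj (hg : 1 ≤ g) {P : Point s} (t : LocalParam P) (t' : LocalParam P.conj)
    (B : RatFunc ℂ) :
    t'.residue (ratFun s B * yFun s) = -t.residue (ratFun s B * yFun s) := by
  cases P with
  | affine a b h =>
    rcases eq_or_ne b 0 with hb | hb
    · rw [residue_ratFun_mul_yFun_branch t hb, neg_zero]
      exact residue_ratFun_mul_yFun_branch (b := -b) t' (by simpa using hb) B
    · exact residue_ratFun_mul_yFun_conj t hb t' B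
  | infinity =>
    rw [residue_ratFun_mul_yFun_infinity hg t, neg_zero]
    exact residue_ratFun_mul_yFun_infinity hg t' B

/-- The points of `Y_s` above `a ∈ ℂ` or at infinity. -/
def pointsAbove (s : Base g) (a : ℂ) : Set (Point s) :=
  {P | P = .infinity ∨ ∃ b h, P = .affine a b h}

theorem pointsAbove_eq {a β : ℂ} (hβ : β ^ 2 = (famPoly s.1).eval a) :
    pointsAbove s a =
      {.infinity, .affine a β hβ, .affine a (-β) (by rwa [neg_sq])} := by
  ext P
  simp only [pointsAbove, Set.mem_ofPred_eq, Set.mem_insert_iff, Set.mem_singleton_iff]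
  refine or_congr_right ⟨?_, ?_⟩
  · rintro ⟨b, h, rfl⟩
    rcases sq_eq_sq_iff_eq_or_eq_neg.mp (h.trans hβ.symm) with rfl | rfl <;> simp
  · rintro (rfl | rfl) <;> exact ⟨_, _, rfl⟩

theorem exists_point_above (s : Base g) (a : ℂ) : ∃ β : ℂ, β ^ 2 = (famPoly s.1).eval a :=
  IsAlgClosed.exists_pow_nat_eq _ two_pos

theorem pointsAbove_finite (s : Base g) (a : ℂ) : (pointsAbove s a).Finite := by
  obtain ⟨β, hβ⟩ := exists_point_above s a
  rw [pointsAbove_eq hβ]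
  exact Set.toFinite _

/-- The residue theorem for the form `w dx`. -/
def ResidueTheorem (param : ∀ P : Point s, LocalParam P) (w : FunField s) : Prop :=
  (Function.support fun P => (param P).residue w).Finite ∧ ∑ᶠ P, (param P).residue w = 0

variable (param : ∀ P : Point s, LocalParam P)

theorem ResidueTheorem.add {v w : FunField s} (hv : ResidueTheorem param v)
    (hw : ResidueTheorem param w) : ResidueTheorem param (v + w) := by
  have h : (fun P => (param P).residue (v + w)) =
      fun P => (param P).residue v + (param P).residue w := funext fun P => LocalParam.residue_add _ _ _
  refine ⟨?_, ?_⟩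
  · rw [h]
    exact (hv.1.union hw.1).subset (Function.support_add _ _)
  · rw [h, finsum_add_distrib hv.1 hw.1, hv.2, hw.2, add_zero]

theorem ResidueTheorem.const_mul (c : ℂ) {w : FunField s} (hw : ResidueTheorem param w) :
    ResidueTheorem param (algebraMap ℂ (FunField s) c * w) := by
  have h : (fun P => (param P).residue (algebraMap ℂ (FunField s) c * w)) =
      fun P => c * (param P).residue w := funext fun P => LocalParam.residue_const_mul _ _ _
  refine ⟨?_, ?_⟩
  · rw [h]
    exact hw.1.subset (Function.support_mul_subset_right _ _)
  · rw [h, ← mul_finsum' _ _ hw.1, hw.2, mul_zero]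

/-- The residues are the orders of `x - a`, whose divisor has degree zero: `-2` at infinity against
`1 + 1` at two conjugate points or `2` at one branch point. -/
theorem residueTheorem_linFrac_inv (hg : 1 ≤ g) (a : ℂ) :
    ResidueTheorem param (ratFun s (linFrac a ^ (-1 : ℤ))) := by
  classical
  obtain ⟨β, hβ⟩ := exists_point_above s a
  have hsupp : (Function.support fun P => (param P).residue (ratFun s (linFrac a ^ (-1 : ℤ)))) ⊆
      pointsAbove s a := by
    intro P hP
    by_contra h
    apply hP
    cases P with
    | infinity => exact absurd (Or.inl rfl) h
    | affine c b hc =>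
      have hca : a ≠ c := by
        rintro rfl
        exact h (Or.inr ⟨b, hc, rfl⟩)
      simpa using (param _).residue_linFrac_inv
        (hasOrder_expand_linFrac_of_ne (param (.affine c b hc)) hca)
  refine ⟨(pointsAbove_finite s a).subset hsupp, ?_⟩
  have hinf := (param _).residue_linFrac_inv
    (hasOrder_expand_linFrac_infinity (param .infinity) hg a)
  rw [pointsAbove_eq hβ] at hsupp
  rcases eq_or_ne β 0 with h0 | h0
  · have hP : Point.affine a (-β) (by rwa [neg_sq]) = (Point.affine a β hβ : Point s) := by
      simp [h0]
    rw [hP, Set.pair_eq_singleton] at hsupp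
    have hfs : ({.infinity, .affine a β hβ} : Set (Point s)) =
      (({.infinity, .affine a β hβ} : Finset (Point s)) : Set (Point s)) := by simp
    rw [hfs] at hsupp
    rw [finsum_eq_sum_of_support_subset _ hsupp, Finset.sum_pair (by simp), hinf,
      (param _).residue_linFrac_inv (hasOrder_branch (param (.affine a β hβ)) h0).2]
    norm_num
  · have h1 : (-β) ^ 2 = (famPoly s.1).eval a := by rwa [neg_sq]
    have hfs : ({.infinity, .affine a β hβ, .affine a (-β) h1} : Set (Point s)) =
      (({.infinity, .affine a β hβ, .affine a (-β) h1} : Finset (Point s)) : Set (Point s)) := by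
        simp
    rw [hfs] at hsupp
    have hne : β ≠ -β := fun h => h0 (self_eq_neg.mp h)
    rw [finsum_eq_sum_of_support_subset _ hsupp, Finset.sum_insert (by simp),
      Finset.sum_pair (by simpa using hne), hinf,
      (param _).residue_linFrac_inv (hasOrder_expand_linFrac (param (.affine a β hβ)) h0),
      (param _).residue_linFrac_inv
        (hasOrder_expand_linFrac (param (.affine a (-β) h1)) (neg_ne_zero.mpr h0))]
    norm_num

theorem residueTheorem_of_eq_zero {w : FunField s} (h : ∀ P, (param P).residue w = 0) :
    ResidueTheorem param w := by
  simp [ResidueTheorem, h, Function.support]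

theorem residueTheorem_ratFun (hg : 1 ≤ g) (A : RatFunc ℂ) :
    ResidueTheorem param (ratFun s A) := by
  induction A using ratFunc_partialFraction_induction with
  | add A B hA hB => rw [map_add]; exact hA.add param hB
  | smul c A hA => rw [map_mul, ratFun_C]; exact hA.const_mul param c
  | X_pow n => exact residueTheorem_of_eq_zero param fun P => (param P).residue_xFun_pow n
  | lin a n =>
    rcases Nat.eq_zero_or_pos n with rfl | hn
    · simpa using residueTheorem_linFrac_inv param hg a
    · exact residueTheorem_of_eq_zero param fun P => (param P).residue_linFrac_zpow a (by omega)

theorem finite_support_residue_mul_yFun (B : RatFunc ℂ) :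
    (Function.support fun P => (param P).residue (ratFun s B * yFun s)).Finite := by
  induction B using ratFunc_partialFraction_induction with
  | add A B hA hB =>
    refine (hA.union hB).subset ?_
    simp only [map_add, add_mul, LocalParam.residue_add]
    exact Function.support_add _ _
  | smul c A hA =>
    refine hA.subset ?_
    simp only [map_mul, ratFun_C, mul_assoc, LocalParam.residue_const_mul]
    exact Function.support_mul_subset_right _ _
  | X_pow n =>
    -- Only infinity can contribute; the value `0` is an arbitrary choice.
    refine (pointsAbove_finite s 0).subset fun P hP => ?_
    by_contra h
    apply hP
    cases P with
    | infinity => exact absurd (Or.inl rfl) h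
    | affine c b hc =>
      apply (param _).residue_eq_zero
      have h1 := orderGE_expand_polyFun (param (.affine c b hc)) (X ^ n)
      rw [map_mul, map_pow, ratFun_X, ← polyFun_X, ← map_pow]
      simpa using (h1.mul (orderGE_expand_yFun _)).mul (orderGE_dx _)
  | lin a n =>
    refine (pointsAbove_finite s a).subset fun P hP => ?_
    by_contra h
    apply hP
    cases P with
    | infinity => exact absurd (Or.inl rfl) h
    | affine c b hc =>
      have hca : a ≠ c := by
        rintro rfl
        exact h (Or.inr ⟨b, hc, rfl⟩)
      apply (param _).residue_eq_zero
      have h1 := (hasOrder_expand_linFrac_of_ne (param (.affine c b hc)) hca).zpow (-(n + 1 : ℤ))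
      rw [map_mul, map_zpow₀, map_zpow₀]
      simpa using (h1.orderGE.mul (orderGE_expand_yFun _)).mul (orderGE_dx _)

/-- The sum of the residues of a meromorphic `1`-form on `Y_s` vanishes. -/
theorem residueTheorem (hg : 1 ≤ g) (w : FunField s) : ResidueTheorem param w := by
  obtain ⟨A, B, rfl⟩ := exists_eq_ratFun_add s w
  refine (residueTheorem_ratFun param hg A).add param
    ⟨finite_support_residue_mul_yFun param B, ?_⟩
  -- Reindexing by the involution changes the sign of every term, so the sum equals its own
  -- negative.
  have h1 := finsum_comp_equiv (f := fun P => (param P).residue (ratFun s B * yFun s))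
    (Function.Involutive.toPerm Point.conj Point.conj_conj)
  have h2 : ∀ P : Point s, (param (Function.Involutive.toPerm Point.conj Point.conj_conj P)).residue
      (ratFun s B * yFun s) = -(param P).residue (ratFun s B * yFun s) :=
    fun P => residue_conj hg _ _ B
  simp only [h2] at h1
  rw [finsum_neg_distrib] at h1
  exact self_eq_neg.mp h1.symm

end Global


/-! ### Existence of local parameters -/

/-- The root is `c` times the binomial series `(1 + X)^(1/2)` evaluated at `f / c² - 1`, which has
no constant term. -/
theorem exists_powerSeries_sqrt (f : PowerSeries ℂ) {c : ℂ} (hc : c ≠ 0)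
    (hf : PowerSeries.constantCoeff f = c ^ 2) :
    ∃ r : PowerSeries ℂ, r ^ 2 = f ∧ PowerSeries.constantCoeff r = c := by
  set u : PowerSeries ℂ := PowerSeries.C (c ^ 2)⁻¹ * f - 1 with hu
  have hu0 : PowerSeries.constantCoeff u = 0 := by
    simp [hu, hf, hc]
  have hs : PowerSeries.HasSubst u := PowerSeries.HasSubst.of_constantCoeff_zero' hu0
  set b : PowerSeries ℂ := PowerSeries.binomialSeries ℂ (1 / 2 : ℚ) with hb
  have hb2 : b ^ 2 = 1 + PowerSeries.X := by
    rw [pow_two, hb, ← PowerSeries.binomialSeries_add]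
    have := PowerSeries.binomialSeries_nat (R := ℚ) (A := ℂ) 1
    norm_num at this ⊢
    exact this
  have hb0 : PowerSeries.constantCoeff b = 1 := PowerSeries.binomialSeries_constantCoeff _
  have h1 : (b.subst u) ^ 2 = 1 + u := by
    rw [← PowerSeries.subst_pow hs, hb2, ← PowerSeries.coe_substAlgHom hs, map_add, map_one,
      PowerSeries.coe_substAlgHom hs, PowerSeries.subst_X hs]
  have h2 : PowerSeries.constantCoeff (b.subst u) = 1 := by
    have h3 : (b.subst u : PowerSeries ℂ) = 1 + (b - 1).subst u := by
      rw [← PowerSeries.coe_substAlgHom hs, map_sub, map_one]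
      ring
    rw [h3, map_add, map_one]
    have := PowerSeries.constantCoeff_subst_eq_zero hu0 (b - 1) (by simp [hb0])
    rw [add_eq_left]
    exact this
  refine ⟨PowerSeries.C c * b.subst u, ?_, by simp [h2]⟩
  rw [mul_pow, h1, hu, add_sub_cancel, ← map_pow, ← mul_assoc, ← map_mul,
    mul_inv_cancel₀ (pow_ne_zero 2 hc), map_one, one_mul]

section

variable {g : ℕ} (s : Base g)

/-- As polynomials split over `ℂ`, `hξ` makes `p(ξ) ≠ 0` for every `p ≠ 0`. Evaluation at `ξ` thus
extends to `ℂ(x)`, and `η` solves the equation of `y`. -/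
theorem exists_expand {ξ η : LaurentSeries ℂ} (hξ : ∀ a, ξ - HahnSeries.C a ≠ 0)
    (h : η ^ 2 = (famPoly s.1).eval₂ HahnSeries.C ξ) :
    ∃ E : FunField s →+* LaurentSeries ℂ,
      (∀ c : ℂ, E (algebraMap ℂ (FunField s) c) = HahnSeries.C c) ∧ E (xFun s) = ξ ∧
        E (yFun s) = η := by
  let φ : ℂ[X] →+* LaurentSeries ℂ := eval₂RingHom HahnSeries.C ξ
  have hφ : ∀ p : ℂ[X], p ≠ 0 → φ p ≠ 0 := by
    intro p hp
    rw [(IsAlgClosed.splits p).eq_prod_roots, map_mul, map_multiset_prod]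
    refine mul_ne_zero ?_ (Multiset.prod_ne_zero ?_)
    · simpa [φ] using hp
    · simp only [Multiset.mem_map, not_exists, not_and, Multiset.map_map]
      intro a _
      simpa [φ] using hξ a
  have hφ' : nonZeroDivisors ℂ[X] ≤ (nonZeroDivisors (LaurentSeries ℂ)).comap φ := by
    intro p hp
    exact mem_nonZeroDivisors_of_ne_zero (hφ p (nonZeroDivisors.ne_zero hp))
  let ψ : RatFunc ℂ →+* LaurentSeries ℂ := RatFunc.liftRingHom φ hφ'
  have hψ : ∀ p : ℂ[X], ψ (algebraMap ℂ[X] (RatFunc ℂ) p) = φ p :=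
    fun p => RatFunc.liftRingHom_algebraMap _ _ _
  have hroot : (curveEq s).eval₂ ψ η = 0 := by
    rw [curveEq_eq, eval₂_sub, eval₂_pow, eval₂_X, eval₂_C, hψ, h]
    exact sub_self _
  refine ⟨AdjoinRoot.lift ψ η hroot, ?_, ?_, ?_⟩
  · intro c
    rw [← ratFun_C]
    refine (AdjoinRoot.lift_of hroot).trans ?_
    rw [← RatFunc.algebraMap_C, hψ]
    simp [φ]
  · rw [← ratFun_X]
    refine (AdjoinRoot.lift_of hroot).trans ?_
    rw [← RatFunc.algebraMap_X, hψ]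
    simp [φ]
  · exact AdjoinRoot.lift_root hroot

theorem noPole_coe (p : PowerSeries ℂ) : NoPole (HahnSeries.ofPowerSeries ℤ ℂ p) := by
  intro n hn
  rw [PowerSeries.coeff_coe]
  simp [hn]

theorem coeff_zero_coe (p : PowerSeries ℂ) :
    (HahnSeries.ofPowerSeries ℤ ℂ p).coeff 0 = PowerSeries.constantCoeff p := by
  rw [PowerSeries.coeff_coe]
  simp

theorem hasOrder_coe_of_ne_zero {p : PowerSeries ℂ} (hp : PowerSeries.constantCoeff p ≠ 0) :
    HasOrder (HahnSeries.ofPowerSeries ℤ ℂ p) 0 :=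
  (noPole_iff.mp (noPole_coe p)).hasOrder (by rwa [coeff_zero_coe])

theorem hasOrder_coe_X : HasOrder (HahnSeries.ofPowerSeries ℤ ℂ PowerSeries.X) 1 := by
  rw [PowerSeries.coe_X]
  exact hasOrder_single one_ne_zero 1

theorem coe_eval₂ (p : ℂ[X]) (q : PowerSeries ℂ) :
    HahnSeries.ofPowerSeries ℤ ℂ (p.eval₂ PowerSeries.C q) =
      p.eval₂ HahnSeries.C (HahnSeries.ofPowerSeries ℤ ℂ q) := by
  rw [hom_eval₂]
  congr 1
  ext1 c
  exact PowerSeries.coe_C c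

theorem constantCoeff_eval₂ (p : ℂ[X]) (q : PowerSeries ℂ) :
    PowerSeries.constantCoeff (p.eval₂ PowerSeries.C q) = p.eval (PowerSeries.constantCoeff q) := by
  rw [hom_eval₂, eval]
  congr 1

theorem HasOrder.sub_C_ne_zero {p : LaurentSeries ℂ} {n : ℤ} (hp : HasOrder p n) (hn : n ≠ 0)
    (a : ℂ) : p - HahnSeries.C a ≠ 0 := by
  intro h
  rw [sub_eq_zero.mp h] at hp
  rcases eq_or_ne a 0 with rfl | ha
  · exact hp.ne_zero (map_zero _)
  · exact hn (hp.unique (hasOrder_C ha))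

theorem add_C_sub_C_ne_zero {p : LaurentSeries ℂ} {n : ℤ} (hp : HasOrder p n) (hn : n ≠ 0)
    (a c : ℂ) : HahnSeries.C a + p - HahnSeries.C c ≠ 0 := by
  have := hp.sub_C_ne_zero hn (c - a)
  rw [map_sub] at this
  convert this using 1
  ring

/-- The expansion is `x = a + t`, `y = √f(a + t)` with the root of value `b` at `t = 0`. -/
theorem nonempty_localParam_affine {a b : ℂ} (hab : b ^ 2 = (famPoly s.1).eval a) (hb : b ≠ 0) :
    Nonempty (LocalParam (Point.affine a b hab)) := by
  set q : PowerSeries ℂ := PowerSeries.C a + PowerSeries.X with hq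
  have hq0 : PowerSeries.constantCoeff q = a := by simp [hq]
  obtain ⟨r, hr, hr0⟩ := exists_powerSeries_sqrt ((famPoly s.1).eval₂ PowerSeries.C q) hb
    (by rw [constantCoeff_eval₂, hq0, hab])
  have hqL : HahnSeries.ofPowerSeries ℤ ℂ q = HahnSeries.C a + HahnSeries.ofPowerSeries ℤ ℂ .X := by
    rw [hq, map_add, PowerSeries.coe_C]
  obtain ⟨E, hE, hx, hy⟩ := exists_expand s (ξ := HahnSeries.ofPowerSeries ℤ ℂ q)
    (η := HahnSeries.ofPowerSeries ℤ ℂ r)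
    (fun c => by rw [hqL]; exact add_C_sub_C_ne_zero hasOrder_coe_X one_ne_zero a c)
    (by rw [← map_pow, hr, coe_eval₂])
  refine ⟨⟨E, hE, ?_, ?_, ?_, ?_, xFun s - algebraMap ℂ (FunField s) a, ?_⟩⟩
  · simpa only [Point.coordOne, hx] using noPole_coe q
  · simpa only [Point.coordTwo, hy] using noPole_coe r
  · simpa only [Point.coordOne, hx, Point.value, coeff_zero_coe] using hq0
  · simpa only [Point.coordTwo, hy, Point.value, coeff_zero_coe] using hr0
  · rw [map_sub, hE, hx, hqL, add_sub_cancel_left]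
    exact (hasOrder_iff.mp hasOrder_coe_X).2

/-- With `f_s = (x - a) f`, the expansion is `x = a + t²`, `y = t √f(a + t²)`. -/
theorem nonempty_localParam_branch {a b : ℂ} (hab : b ^ 2 = (famPoly s.1).eval a) (hb : b = 0) :
    Nonempty (LocalParam (Point.affine a b hab)) := by
  subst hb
  obtain ⟨f, hf, hfa⟩ := exists_famPoly_eq_mul s
    (show (famPoly s.1).eval a = 0 by rw [← hab]; ring)
  obtain ⟨c, hc⟩ := IsAlgClosed.exists_pow_nat_eq (f.eval a) two_pos
  have hc0 : c ≠ 0 := by rintro rfl; exact hfa (by rw [← hc]; ring)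
  set q : PowerSeries ℂ := PowerSeries.C a + PowerSeries.X ^ 2 with hq
  have hq0 : PowerSeries.constantCoeff q = a := by simp [hq]
  obtain ⟨r, hr, hr0⟩ := exists_powerSeries_sqrt (f.eval₂ PowerSeries.C q) hc0
    (by rw [constantCoeff_eval₂, hq0, hc])
  have hqL : HahnSeries.ofPowerSeries ℤ ℂ q =
      HahnSeries.C a + HahnSeries.ofPowerSeries ℤ ℂ .X ^ 2 := by
    rw [hq, map_add, PowerSeries.coe_C, map_pow]
  have hX2 := hasOrder_coe_X.pow 2
  obtain ⟨E, hE, hx, hy⟩ := exists_expand s (ξ := HahnSeries.ofPowerSeries ℤ ℂ q)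
    (η := HahnSeries.ofPowerSeries ℤ ℂ (PowerSeries.X * r))
    (fun c => by rw [hqL]; exact add_C_sub_C_ne_zero hX2 (by norm_num) a c)
    (by
      rw [← map_pow, ← coe_eval₂, hf, eval₂_mul, ← hr, eval₂_sub, eval₂_X, eval₂_C, hq]
      congr 1; ring)
  refine ⟨⟨E, hE, ?_, ?_, ?_, ?_, yFun s, ?_⟩⟩
  · simpa only [Point.coordOne, hx] using noPole_coe q
  · simpa only [Point.coordTwo, hy] using noPole_coe _
  · simpa only [Point.coordOne, hx, Point.value, coeff_zero_coe] using hq0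
  · simp only [Point.coordTwo, hy, Point.value, coeff_zero_coe]
    simp
  · rw [hy, map_mul]
    have h := hasOrder_coe_X.mul (hasOrder_coe_of_ne_zero (p := r) (by rwa [hr0]))
    exact (hasOrder_iff.mp h).2

/-- The expansion is `x = t⁻²`, `y = t^(-2g-1) R`, where `R²` is the reversed polynomial of `f_s` at
`t²`; its constant term is `1` because `f_s` is monic. -/
theorem nonempty_localParam_infinity (hg : 1 ≤ g) :
    Nonempty (LocalParam (Point.infinity : Point s)) := by
  set T := HahnSeries.ofPowerSeries ℤ ℂ PowerSeries.X with hT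
  have hT1 : HasOrder T 1 := hasOrder_coe_X
  have hT0 : T ≠ 0 := hT1.ne_zero
  have hrev : (famPoly s.1).reverse.eval 0 = 1 := by
    rw [← coeff_zero_eq_eval_zero, coeff_zero_reverse, famPoly_monic]
  obtain ⟨r, hr, hr0⟩ := exists_powerSeries_sqrt
    ((famPoly s.1).reverse.eval₂ PowerSeries.C (PowerSeries.X ^ 2)) one_ne_zero
    (by rw [constantCoeff_eval₂]; simp [hrev])
  set R := HahnSeries.ofPowerSeries ℤ ℂ r with hR
  have hR0 : HasOrder R 0 := hasOrder_coe_of_ne_zero (by rw [hr0]; exact one_ne_zero)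
  have hRR : R ^ 2 = (famPoly s.1).reverse.eval₂ HahnSeries.C (T ^ 2) := by
    rw [hR, ← map_pow, hr, coe_eval₂, map_pow]
  obtain ⟨E, hE, hx, hy⟩ := exists_expand s (ξ := (T ^ 2)⁻¹) (η := R * (T ^ (2 * g + 1))⁻¹)
    (fun c => (hT1.pow 2).inv.sub_C_ne_zero (by norm_num) c) (by
      let _ : Invertible (T ^ 2)⁻¹ := invertibleOfNonzero (inv_ne_zero (pow_ne_zero 2 hT0))
      have h := eval₂_reverse_mul_pow HahnSeries.C (T ^ 2)⁻¹ (famPoly s.1)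
      rw [← h, invOf_eq_inv, inv_inv, ← hRR, famPoly_natDegree s hg]
      ring)
  have hv : E (yFun s / xFun s ^ (g + 1)) = T * R := by
    rw [map_div₀, map_pow, hx, hy, inv_pow, ← pow_mul, show 2 * (g + 1) = 2 * g + 1 + 1 by ring,
      pow_succ]
    field_simp
    ring
  have hu : E (xFun s)⁻¹ = T ^ 2 := by rw [map_inv₀, hx, inv_inv]
  have hv' : T * R = HahnSeries.ofPowerSeries ℤ ℂ (PowerSeries.X * r) := by rw [map_mul]
  have hu' : T ^ 2 = HahnSeries.ofPowerSeries ℤ ℂ (PowerSeries.X ^ 2) := by rw [map_pow]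
  refine ⟨⟨E, hE, ?_, ?_, ?_, ?_, yFun s / xFun s ^ (g + 1), ?_⟩⟩
  · simpa only [Point.coordOne, hu, hu'] using noPole_coe _
  · simpa only [Point.coordTwo, hv, hv'] using noPole_coe _
  · simp only [Point.coordOne, hu, hu', Point.value, coeff_zero_coe]
    simp
  · simp only [Point.coordTwo, hv, hv', Point.value, coeff_zero_coe]
    simp
  · rw [hv]
    exact (hasOrder_iff.mp (hT1.mul hR0)).2

theorem nonempty_localParam (hg : 1 ≤ g) (P : Point s) : Nonempty (LocalParam P) := by
  cases P with
  | affine a b h =>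
    by_cases hb : b = 0
    · exact nonempty_localParam_branch s h hb
    · exact nonempty_localParam_affine s h hb
  | infinity => exact nonempty_localParam_infinity s hg

end


/-! ### Lifts of tangent vectors -/

section Lifts

variable {g : ℕ} {s : Base g} {v : Tangent g}

theorem Lift.tangent_eq (D : Lift s v) : 2 * yFun s * D.ydot =
    polyFun s (derivative (famPoly s.1)) * D.xdot + polyFun s (famPolyDeriv s.1 v) := by
  rw [← aeval_xFun, ← aeval_xFun]
  exact D.tangent

theorem regularAt_iff {P : Point s} {h : FunField s} :
    RegularAt P h ↔ ∀ t : LocalParam P, OrderGE (t.expand h) 0 :=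
  forall_congr' fun _ => noPole_iff

theorem mem_quadDiff_iff {h : FunField s} :
    h ∈ QuadDiff s ↔ ∀ (P : Point s) (t : LocalParam P), OrderGE (t.expand h * t.dx ^ 2) 0 :=
  forall_congr' fun _ => forall_congr' fun _ => noPole_iff

theorem hasOrder_expand_two {P : Point s} (t : LocalParam P) : HasOrder (t.expand 2) 0 := by
  have h := hasOrder_C (two_ne_zero (α := ℂ))
  rwa [map_ofNat, ← map_ofNat t.expand] at h

theorem Lift.regularAt_affine_iff {D : Lift s v} {a b : ℂ} {hab : b ^ 2 = (famPoly s.1).eval a} :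
    D.RegularAt (.affine a b hab) ↔
      (∀ t : LocalParam (Point.affine a b hab), OrderGE (t.expand D.xdot) 0) ∧
      ∀ t : LocalParam (Point.affine a b hab), OrderGE (t.expand D.ydot) 0 :=
  and_congr regularAt_iff regularAt_iff

theorem Lift.regularAt_infinity_iff {D : Lift s v} :
    D.RegularAt .infinity ↔
      (∀ t : LocalParam (Point.infinity : Point s),
        OrderGE (t.expand (-D.xdot / xFun s ^ 2)) 0) ∧
      ∀ t : LocalParam (Point.infinity : Point s), OrderGE (t.expand
        (D.ydot / xFun s ^ (g + 1) - (g + 1) * yFun s * D.xdot / xFun s ^ (g + 2))) 0 :=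
  and_congr regularAt_iff regularAt_iff

theorem funField_two_ne_zero : (2 : FunField s) ≠ 0 := by
  rw [← map_ofNat (algebraMap ℂ (FunField s)) 2]
  exact (map_ne_zero_iff _ (algebraMap ℂ (FunField s)).injective).mpr two_ne_zero

/-- The lift of `v` whose `x`-component is the constant `c`. -/
def constLift (s : Base g) (v : Tangent g) (c : ℂ) : Lift s v where
  xdot := polyFun s (C c)
  ydot := polyFun s (derivative (famPoly s.1) * C c + famPolyDeriv s.1 v) / (2 * yFun s)
  tangent := by
    rw [mul_div_cancel₀ _ (mul_ne_zero funField_two_ne_zero (yFun_ne_zero s)), aeval_xFun, aeval_xFun,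
      map_add, map_mul]

theorem constLift_xdot (c : ℂ) : (constLift s v c).xdot = polyFun s (C c) := rfl

theorem constLift_ydot (c : ℂ) : (constLift s v c).ydot =
    polyFun s (derivative (famPoly s.1) * C c + famPolyDeriv s.1 v) / (2 * yFun s) := rfl

theorem constLift_regularAt_affine {a b : ℂ} (hab : b ^ 2 = (famPoly s.1).eval a) (hb : b ≠ 0)
    (c : ℂ) : (constLift s v c).RegularAt (.affine a b hab) := by
  refine Lift.regularAt_affine_iff.mpr ⟨fun t => ?_, fun t => ?_⟩
  · rw [constLift_xdot]
    exact orderGE_expand_polyFun t _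
  rw [constLift_ydot, map_div₀, map_mul]
  have h := orderGE_expand_polyFun t (derivative (famPoly s.1) * C c + famPolyDeriv s.1 v)
  exact (h.div ((hasOrder_expand_two t).mul (hasOrder_expand_yFun_of_ne t hb))).mono (by norm_num)

/-- The value at a branch point of the `x`-component of a regular lift. -/
def branchVelocity (s : Base g) (v : Tangent g) (a : ℂ) : ℂ :=
  -(famPolyDeriv s.1 v).eval a / (derivative (famPoly s.1)).eval a

/-- This is the numerator of `ydot = (f' xdot + ∂_v f) / (2y)`; its vanishing at `a` compensates the
zero of `y`. -/
theorem eval_branchVelocity {a : ℂ} (ha : (famPoly s.1).eval a = 0) :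
    (derivative (famPoly s.1) * C (branchVelocity s v a) + famPolyDeriv s.1 v).eval a = 0 := by
  have := famPoly_deriv_eval_ne_zero s ha
  simp only [eval_add, eval_mul, eval_C, branchVelocity]
  field_simp
  ring

theorem constLift_regularAt_branch {a b : ℂ} (hab : b ^ 2 = (famPoly s.1).eval a) (hb : b = 0) :
    (constLift s v (branchVelocity s v a)).RegularAt (.affine a b hab) := by
  refine Lift.regularAt_affine_iff.mpr ⟨fun t => ?_, fun t => ?_⟩
  · rw [constLift_xdot]
    exact orderGE_expand_polyFun t _
  rw [constLift_ydot, map_div₀, map_mul]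
  simpa using (orderGE_expand_polyFun_of_root t
    (eval_branchVelocity (v := v) (s := s) (by rw [← hab, hb]; ring))).div
    ((hasOrder_expand_two t).mul (hasOrder_branch t hb).1)

/-- With `xdot = 0`, the component along `v` is `∂_v f / (2 y x^(g+1))`, of order at least `-4g +
(2g + 1) + (2g + 2) = 3`. -/
theorem constLift_regularAt_infinity (hg : 1 ≤ g) :
    (constLift s v 0).RegularAt .infinity := by
  refine Lift.regularAt_infinity_iff.mpr ⟨fun t => ?_, fun t => ?_⟩
  · simpa [constLift_xdot] using orderGE_zero 0
  · obtain ⟨hx, hy, -⟩ := hasOrder_infinity t hg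
    have h1 := ((orderGE_expand_polyFun_infinity t hg (famPolyDeriv_natDegree_le s hg v)).div
      ((hasOrder_expand_two t).mul hy)).div (hx.pow (g + 1))
    simp only [constLift_xdot, constLift_ydot, map_zero, mul_zero, zero_add, zero_div, sub_zero]
    rw [map_div₀, map_div₀, map_mul, map_pow]
    exact h1.mono (by push_cast; linarith)

theorem nonempty_liftData (hg : 1 ≤ g) (s : Base g) (v : Tangent g) : Nonempty (LiftData s v) := by
  have h : ∀ P : Point s, ∃ D : Lift s v, D.RegularAt P := by
    intro P
    cases P with
    | affine a b hab =>
      by_cases hb : b = 0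
      · exact ⟨_, constLift_regularAt_branch hab hb⟩
      · exact ⟨_, constLift_regularAt_affine hab hb 0⟩
    | infinity => exact ⟨_, constLift_regularAt_infinity hg⟩
  choose loc hloc using h
  exact ⟨⟨constLift s v 0, loc, hloc, fun P => (nonempty_localParam s hg P).some⟩⟩

/-! ### Contraction of regular lifts with quadratic differentials -/

/-- A form `ξ ⌟ (h dx²)` has no pole when the vector field `ξ ∂/∂x` and `h dx²` are regular. -/
theorem LocalParam.residue_mul_eq_zero {P : Point s} (t : LocalParam P) {ξ h : FunField s}
    (hh : h ∈ QuadDiff s) {n : ℤ} (hdx : HasOrder t.dx n) (hξ : OrderGE (t.expand ξ) n) :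
    t.residue (ξ * h) = 0 := by
  apply t.residue_eq_zero
  have h1 := (hξ.div hdx).mul (mem_quadDiff_iff.mp hh P t)
  rw [sub_self, add_zero] at h1
  convert h1 using 1
  have := hdx.ne_zero
  rw [map_mul]
  field_simp

theorem residue_lift_affine {a b : ℂ} {hab : b ^ 2 = (famPoly s.1).eval a}
    (t : LocalParam (Point.affine a b hab)) (hb : b ≠ 0) {h : FunField s} (hh : h ∈ QuadDiff s)
    {D : Lift s v} (hD : D.RegularAt (.affine a b hab)) : t.residue (D.xdot * h) = 0 :=
  t.residue_mul_eq_zero hh (hasOrder_dx t hb) ((Lift.regularAt_affine_iff.mp hD).1 t)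

/-- As `f' xdot + ∂_v f = 2 y ydot` vanishes at the point and `f'` does not, `xdot` differs from the
branch velocity by a function of order at least `1`. The zero of this difference cancels that of
`dx`, so only the constant contributes. -/
theorem residue_lift_branch {a b : ℂ} {hab : b ^ 2 = (famPoly s.1).eval a}
    (t : LocalParam (Point.affine a b hab)) (hb : b = 0) {h : FunField s} (hh : h ∈ QuadDiff s)
    {D : Lift s v} (hD : D.RegularAt (.affine a b hab)) :
    t.residue (D.xdot * h) = branchVelocity s v a * t.residue h := by
  have hroot : (famPoly s.1).eval a = 0 := by rw [← hab, hb]; ring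
  set c := branchVelocity s v a with hc
  have hf' := hasOrder_expand_polyFun t (famPoly_deriv_eval_ne_zero s hroot)
  have h1 : OrderGE (t.expand (D.xdot - algebraMap ℂ (FunField s) c)) 1 := by
    have h2 := ((hasOrder_expand_two t).mul (hasOrder_branch t hb).1).orderGE.mul
      ((Lift.regularAt_affine_iff.mp hD).2 t)
    have h3 := orderGE_expand_polyFun_of_root t (eval_branchVelocity (v := v) (s := s) hroot)
    have h4 := ((h2.mono (by norm_num)).sub h3).div hf'
    rw [sub_zero] at h4
    convert h4 using 1
    rw [eq_div_iff hf'.ne_zero, ← map_mul, ← map_mul, ← map_mul, ← map_sub, D.tangent_eq, ← hc,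
      map_add (polyFun s), map_mul (polyFun s), polyFun_C]
    congr 1
    ring
  have h5 := t.residue_mul_eq_zero hh (hasOrder_dx_branch t hb) h1
  rwa [sub_mul, t.residue_sub, t.residue_const_mul, sub_eq_zero] at h5

/-- What is needed is `ord xdot ≥ -3`, the order of `dx`. Regularity of `-xdot / x²` gives only
`-4`; the bound comes from the second component. -/
theorem residue_lift_infinity (hg : 1 ≤ g) (t : LocalParam (Point.infinity : Point s))
    {h : FunField s} (hh : h ∈ QuadDiff s) {D : Lift s v} (hD : D.RegularAt .infinity) :
    t.residue (D.xdot * h) = 0 := by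
  apply t.residue_mul_eq_zero hh (hasOrder_dx_infinity t hg)
  obtain ⟨hx, hy, -⟩ := hasOrder_infinity t hg
  have hx0 := xFun_ne_zero s
  set V := D.ydot / xFun s ^ (g + 1) - (g + 1) * yFun s * D.xdot / xFun s ^ (g + 2) with hV
  have hVreg : OrderGE (t.expand V) 0 := (Lift.regularAt_infinity_iff.mp hD).2 t
  -- Eliminating `ydot` between tangency and `V` leaves `xdot` with the factor `p = x f' - (2g+2)
  -- f`. Its top coefficient is `(2g + 1) - (2g + 2) = -1`, so `p` has order at most `-(4g + 2)`,
  -- while the other side of `hid` has order at least `-2 - (4g + 3)`.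
  set p : ℂ[X] := derivative (famPoly s.1) * X - C (2 * (g + 1) : ℂ) * famPoly s.1 with hp
  have hcoeff : p.coeff (2 * g + 1) = -1 := by
    have h1 := famPoly_natDegree s hg
    have h2 : (famPoly s.1).coeff (2 * g + 1) = 1 := by
      rw [← h1]; exact famPoly_monic s
    rw [hp, coeff_sub, coeff_mul_X, coeff_C_mul, coeff_derivative, h2]
    push_cast; ring
  have hp0 : p ≠ 0 := by rintro h0; rw [h0] at hcoeff; simp at hcoeff
  have hpdeg : 2 * g + 1 ≤ p.natDegree := le_natDegree_of_ne_zero (by rw [hcoeff]; norm_num)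
  have hpo := hasOrder_expand_polyFun_infinity t hg hp0
  have hid : D.xdot * polyFun s p =
      xFun s * (2 * yFun s * xFun s ^ (g + 1) * V - polyFun s (famPolyDeriv s.1 v)) := by
    have h1 := D.tangent_eq
    have h2 : polyFun s (C (2 * (g + 1) : ℂ)) = 2 * (g + 1) := by
      rw [polyFun_C, map_mul, map_ofNat, map_add, map_natCast, map_one]
    have h3 := yFun_sq_eq s
    have h4 : xFun s * xFun s ^ (g + 1) * V =
        xFun s * D.ydot - (g + 1) * yFun s * D.xdot := by
      rw [hV]; field_simp; ring
    rw [hp, map_sub, map_mul, map_mul, polyFun_X, h2, ← h3]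
    linear_combination (-2 * yFun s) * h4 - xFun s * h1
  have h5 : D.xdot = xFun s * (2 * yFun s * xFun s ^ (g + 1) * V - polyFun s (famPolyDeriv s.1 v)) /
      polyFun s p := by
    rw [eq_div_iff (polyFun_ne_zero s hp0), hid]
  rw [h5, map_div₀, map_mul, map_sub, map_mul, map_mul, map_mul, map_pow]
  have h6 := (((hasOrder_expand_two t).mul hy).mul (hx.pow (g + 1))).orderGE.mul hVreg
  have h7 := orderGE_expand_polyFun_infinity t hg (famPolyDeriv_natDegree_le s hg v)
  have h8 := (hx.orderGE.mul ((h6.mono (m := -(4 * g + 3)) (by push_cast; linarith)).sub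
    (h7.mono (by push_cast; linarith)))).div hpo
  exact h8.mono (by omega)

/-- The branch point above `s_i`. -/
def branchPoint (s : Base g) (i : Fin (2 * g - 1)) : Point s :=
  .affine (s.1 i) 0 (by rw [famPoly_eval_s]; ring)

theorem branchPoint_injective (s : Base g) : Function.Injective (branchPoint s) := by
  intro i j h
  simp only [branchPoint, Point.affine.injEq, and_true] at h
  exact s.2.2 h

/-- At a branch point, residues do not depend on the local parameter. -/
theorem residue_branch_congr {a b : ℂ} {hab : b ^ 2 = (famPoly s.1).eval a}
    (t t' : LocalParam (Point.affine a b hab)) (hb : b = 0) (h : FunField s) :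
    t.residue h = t'.residue h := by
  obtain ⟨A, B, rfl⟩ := exists_eq_ratFun_add s h
  rw [t.residue_add, t'.residue_add, residue_ratFun_mul_yFun_branch t hb,
    residue_ratFun_mul_yFun_branch t' hb, t.residue_ratFun_congr t']
  intro c
  rcases eq_or_ne c a with rfl | hc
  · exact ⟨2, (hasOrder_branch t hb).2, (hasOrder_branch t' hb).2⟩
  · exact ⟨0, hasOrder_expand_linFrac_of_ne t hc, hasOrder_expand_linFrac_of_ne t' hc⟩

theorem branchVelocity_s (i : Fin (2 * g - 1)) : branchVelocity s v (s.1 i) = v i := by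
  have := famPoly_deriv_eval_ne_zero s (famPoly_eval_s s i)
  rw [branchVelocity, famPolyDeriv_eval_s]
  field_simp

/-- The remaining branch points lie above `0` and `1`, which do not move with `s`. -/
theorem residue_loc_of_notMem (hg : 1 ≤ g) (d : LiftData s v) {h : FunField s}
    (hh : h ∈ QuadDiff s) {P : Point s} (hP : P ∉ Set.range (branchPoint s)) :
    (d.param P).residue ((d.loc P).xdot * h) = 0 := by
  have hreg := d.loc_regular P
  cases P with
  | infinity => exact residue_lift_infinity hg _ hh hreg
  | affine a b hab =>
    by_cases hb : b = 0
    · rw [residue_lift_branch _ hb hh hreg]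
      have hroot : (famPoly s.1).eval a = 0 := by rw [← hab, hb]; ring
      have h01 : a = 0 ∨ a = 1 := by
        rcases (famPoly_isRoot_iff s a).mp hroot with h | h | ⟨i, rfl⟩
        · exact Or.inl h
        · exact Or.inr h
        · subst hb
          exact absurd ⟨i, rfl⟩ hP
      rw [branchVelocity, famPolyDeriv_eval_zero_or_one s v h01, neg_zero, zero_div, zero_mul]
    · exact residue_lift_affine _ hb hh hreg

/-- The local formula for the Kodaira–Spencer map. -/
theorem finsum_term_eq (hg : 1 ≤ g) (d : LiftData s v) {h : FunField s} (hh : h ∈ QuadDiff s) :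
    (Function.support (d.term h)).Finite ∧
      ∑ᶠ P, d.term h P = ∑ i, v i * (d.param (branchPoint s i)).residue h := by
  classical
  have hterm : d.term h = fun P => (d.param P).residue ((d.loc P).xdot * h) -
      (d.param P).residue (d.glob.xdot * h) := by
    ext P
    rw [LiftData.term, sub_mul, LocalParam.residue_sub]
  -- The global lift drops out of the sum by the residue theorem.
  obtain ⟨hfin, hsum⟩ := residueTheorem d.param hg (d.glob.xdot * h)
  have hsupp : (Function.support fun P => (d.param P).residue ((d.loc P).xdot * h)) ⊆
      ((Finset.univ.image (branchPoint s) : Finset (Point s)) : Set (Point s)) := by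
    intro P hP
    rw [Finset.coe_image, Finset.coe_univ, Set.image_univ]
    by_contra hP'
    exact hP (residue_loc_of_notMem hg d hh hP')
  have hfin' := (Finset.finite_toSet _).subset hsupp
  refine ⟨?_, ?_⟩
  · rw [hterm]
    exact (hfin'.union hfin).subset (Function.support_sub _ _)
  · rw [hterm, finsum_sub_distrib hfin' hfin, hsum, sub_zero,
      finsum_eq_sum_of_support_subset _ hsupp,
      Finset.sum_image fun i _ j _ h => branchPoint_injective s h]
    refine Finset.sum_congr rfl fun i _ => ?_
    have := residue_lift_branch (d.param (branchPoint s i)) rfl hh (d.loc_regular (branchPoint s i))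
    exact this.trans (by rw [branchVelocity_s]; rfl)

/-! ### The Kodaira–Spencer map as a combination of branch residues. -/

/-- The residue at the branch point above `s_i`, as a functional on quadratic differentials. -/
def branchResidue (hg : 1 ≤ g) (s : Base g) (i : Fin (2 * g - 1)) :
    Module.Dual ℂ (QuadDiff s) where
  toFun q := (nonempty_localParam s hg (branchPoint s i)).some.residue (q : FunField s)
  map_add' q r := by rw [Submodule.coe_add, LocalParam.residue_add]
  map_smul' c q := by
    rw [Submodule.coe_smul, Algebra.smul_def, LocalParam.residue_const_mul]
    rfl

theorem branchResidue_apply (hg : 1 ≤ g) (i : Fin (2 * g - 1)) (t : LocalParam (branchPoint s i))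
    (q : QuadDiff s) : branchResidue hg s i q = t.residue (q : FunField s) :=
  residue_branch_congr _ t rfl _

/-- The Kodaira–Spencer map. -/
def kodairaSpencer (hg : 1 ≤ g) (s : Base g) : Tangent g →ₗ[ℂ] Module.Dual ℂ (QuadDiff s) :=
  ∑ i, (LinearMap.proj i : Tangent g →ₗ[ℂ] ℂ).smulRight (branchResidue hg s i)

theorem kodairaSpencer_apply (hg : 1 ≤ g) (v : Tangent g) (q : QuadDiff s) :
    kodairaSpencer hg s v q = ∑ i, v i * branchResidue hg s i q := by
  simp [kodairaSpencer, LinearMap.sum_apply]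

theorem kodairaSpencer_single (hg : 1 ≤ g) (i : Fin (2 * g - 1)) (q : QuadDiff s) :
    kodairaSpencer hg s (Pi.single i 1) q = branchResidue hg s i q := by
  rw [kodairaSpencer_apply, Finset.sum_eq_single i]
  · simp
  · intro k _ hk
    simp [hk]
  · simp

theorem isKodairaSpencer (hg : 1 ≤ g) (s : Base g) :
    IsKodairaSpencer s (kodairaSpencer hg s) := by
  intro v
  refine ⟨nonempty_liftData hg s v, fun d q => ?_⟩
  obtain ⟨h1, h2⟩ := finsum_term_eq hg d q.2
  refine ⟨h1, ?_⟩
  rw [h2, kodairaSpencer_apply]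
  exact Finset.sum_congr rfl fun i _ => by rw [branchResidue_apply hg i]

end Lifts


/-! ### Even and odd quadratic differentials -/

section QuadraticDifferentials

variable {g : ℕ} {s : Base g}

theorem hypInv_const (c : ℂ) :
    hypInv s (algebraMap ℂ (FunField s) c) = algebraMap ℂ (FunField s) c := by
  rw [← ratFun_C, hypInv_ratFun]

theorem hypInv_hypInv (h : FunField s) : hypInv s (hypInv s h) = h := by
  obtain ⟨A, B, rfl⟩ := exists_eq_ratFun_add s h
  simp only [map_add, map_mul, hypInv_ratFun, hypInv_yFun, map_neg, neg_neg]

/-- The local parameter at the image of a point under the hyperelliptic involution. -/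
def LocalParam.conj {P : Point s} (t : LocalParam P) : LocalParam P.conj where
  expand := t.expand.comp (hypInv s : FunField s →+* FunField s)
  expand_const c := by
    rw [RingHom.comp_apply, RingHom.coe_coe, hypInv_const, t.expand_const]
  noPole_one := by
    have h := t.noPole_one
    cases P <;> simpa [Point.conj, Point.coordOne, ← ratFun_X, hypInv_ratFun] using h
  noPole_two := by
    have h := t.noPole_two
    have h2 : t.expand (hypInv s P.coordTwo) = -t.expand P.coordTwo := by
      cases P <;> simp [Point.coordTwo, ← ratFun_X, hypInv_ratFun, hypInv_yFun, neg_div]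
    have h3 : P.conj.coordTwo = P.coordTwo := by cases P <;> rfl
    rw [h3, RingHom.comp_apply, RingHom.coe_coe, h2]
    exact noPole_iff.mpr (noPole_iff.mp h).neg
  value_one := by
    have h := t.value_one
    cases P <;> simpa [Point.conj, Point.coordOne, Point.value, ← ratFun_X, hypInv_ratFun] using h
  value_two := by
    have h := t.value_two
    have h2 : t.expand (hypInv s P.coordTwo) = -t.expand P.coordTwo := by
      cases P <;> simp [Point.coordTwo, ← ratFun_X, hypInv_ratFun, hypInv_yFun, neg_div]
    have h3 : P.conj.coordTwo = P.coordTwo := by cases P <;> rfl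
    have h4 : P.conj.value.2 = -P.value.2 := by cases P <;> simp [Point.conj, Point.value]
    rw [h3, RingHom.comp_apply, RingHom.coe_coe, h2, h4, HahnSeries.coeff_neg, h]
  order_one := by
    obtain ⟨h, hh⟩ := t.order_one
    exact ⟨hypInv s h, by rwa [RingHom.comp_apply, RingHom.coe_coe, hypInv_hypInv]⟩

theorem LocalParam.conj_dx {P : Point s} (t : LocalParam P) : t.conj.dx = t.dx := by
  rw [t.conj.dx_eq, t.dx_eq]
  congr 1
  change t.expand (hypInv s (xFun s)) = _
  rw [← ratFun_X, hypInv_ratFun]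

/-- Expanding `ι^* h` at `P` is expanding `h` with the conjugate parameter at `ι(P)`, and `dx` is
unchanged. -/
theorem hypInv_mem_quadDiff {h : FunField s} (hh : h ∈ QuadDiff s) : hypInv s h ∈ QuadDiff s := by
  rw [mem_quadDiff_iff] at *
  intro P t
  have := hh _ t.conj
  rwa [t.conj_dx] at this

theorem mem_oddQuadDiff_iff {q : QuadDiff s} :
    q ∈ OddQuadDiff s ↔ hypInv s (q : FunField s) = -(q : FunField s) := Iff.rfl

/-- Every quadratic differential is the sum of an even and an odd one. -/
theorem exists_even_add_odd (q : QuadDiff s) : ∃ (A : RatFunc ℂ) (hA : ratFun s A ∈ QuadDiff s)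
    (o : QuadDiff s), o ∈ OddQuadDiff s ∧ q = ⟨ratFun s A, hA⟩ + o := by
  obtain ⟨A, B, hq⟩ := exists_eq_ratFun_add s (q : FunField s)
  -- The even part is an average over the involution, hence regular.
  have h1 : ratFun s A = (2⁻¹ : ℂ) • ((q : FunField s) + hypInv s (q : FunField s)) := by
    rw [hq, Algebra.smul_def, map_inv₀, map_ofNat]
    simp only [map_add, map_mul, hypInv_ratFun, hypInv_yFun]
    have := funField_two_ne_zero (s := s)
    field_simp
    ring
  have hA : ratFun s A ∈ QuadDiff s := by
    rw [h1]
    exact Submodule.smul_mem _ _ (Submodule.add_mem _ q.2 (hypInv_mem_quadDiff q.2))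
  refine ⟨A, hA, q - ⟨ratFun s A, hA⟩, ?_, by abel⟩
  rw [mem_oddQuadDiff_iff]
  simp only [Submodule.coe_sub, hq, add_sub_cancel_left, map_mul, hypInv_ratFun, hypInv_yFun]
  ring

theorem branchResidue_odd (hg : 1 ≤ g) (i : Fin (2 * g - 1)) {q : QuadDiff s}
    (hq : q ∈ OddQuadDiff s) : branchResidue hg s i q = 0 := by
  obtain ⟨t⟩ := nonempty_localParam s hg (branchPoint s i)
  rw [branchResidue_apply hg i t]
  rw [mem_oddQuadDiff_iff] at hq
  obtain ⟨A, B, h⟩ := exists_eq_ratFun_add s (q : FunField s)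
  rw [h] at hq ⊢
  simp only [map_add, map_mul, hypInv_ratFun, hypInv_yFun] at hq
  have hA : ratFun s A = 0 := by
    have h2 : 2 * ratFun s A = 0 := by linear_combination hq
    exact (mul_eq_zero.mp h2).resolve_left funField_two_ne_zero
  rw [hA, zero_add]
  exact residue_ratFun_mul_yFun_branch t rfl B

/-- At a branch point `dx²` cancels the double pole of `1 / y²`. At infinity the order is at least
`-2(2g - 2) + 2(2g + 1) - 6 = 0`, so the degree bound is sharp. -/
theorem polyFun_div_sq_mem_quadDiff (hg : 1 ≤ g) {p : ℂ[X]} (hp : p.natDegree ≤ 2 * g - 2) :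
    polyFun s p / yFun s ^ 2 ∈ QuadDiff s := by
  rw [mem_quadDiff_iff]
  intro P t
  rw [map_div₀, map_pow]
  cases P with
  | affine a b hab =>
    have hp' := orderGE_expand_polyFun t p
    by_cases hb : b = 0
    · exact ((hp'.div ((hasOrder_branch t hb).1.pow 2)).mul
        ((hasOrder_dx_branch t hb).pow 2).orderGE).mono (by norm_num)
    · exact ((hp'.div ((hasOrder_expand_yFun_of_ne t hb).pow 2)).mul
        ((hasOrder_dx t hb).pow 2).orderGE).mono (by norm_num)
  | infinity =>
    refine (((orderGE_expand_polyFun_infinity t hg hp).div ((hasOrder_infinity t hg).2.1.pow 2)).mul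
      ((hasOrder_dx_infinity t hg).pow 2).orderGE).mono ?_
    push_cast
    omega

theorem xFun_pow_div_sq_mem_quadDiff (hg : 1 ≤ g) (j : Fin (2 * g - 1)) :
    xFun s ^ (j : ℕ) / yFun s ^ 2 ∈ QuadDiff s := by
  rw [← polyFun_X, ← map_pow]
  exact polyFun_div_sq_mem_quadDiff hg (by rw [natDegree_X_pow]; omega)

/-- The order at infinity is `-2j + (2g + 1) - 6 = 2(g - 3 - j) + 1`, which is where the bound on
`j` comes from. -/
theorem xFun_pow_div_mem_quadDiff (hg : 1 ≤ g) {j : ℕ} (hj : j + 3 ≤ g) :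
    xFun s ^ j / yFun s ∈ QuadDiff s := by
  rw [← polyFun_X, ← map_pow, mem_quadDiff_iff]
  intro P t
  rw [map_div₀]
  cases P with
  | affine a b hab =>
    have hp' := orderGE_expand_polyFun t (X ^ j)
    by_cases hb : b = 0
    · exact ((hp'.div (hasOrder_branch t hb).1).mul
        ((hasOrder_dx_branch t hb).pow 2).orderGE).mono (by norm_num)
    · exact ((hp'.div (hasOrder_expand_yFun_of_ne t hb)).mul
        ((hasOrder_dx t hb).pow 2).orderGE).mono (by norm_num)
  | infinity =>
    refine (((orderGE_expand_polyFun_infinity t hg (natDegree_X_pow_le j)).div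
      (hasOrder_infinity t hg).2.1).mul ((hasOrder_dx_infinity t hg).pow 2).orderGE).mono ?_
    push_cast
    omega

theorem xFun_pow_div_mem_oddQuadDiff {j : ℕ} (h : xFun s ^ j / yFun s ∈ QuadDiff s) :
    (⟨_, h⟩ : QuadDiff s) ∈ OddQuadDiff s := by
  rw [mem_oddQuadDiff_iff]
  simp only [map_div₀, map_pow, hypInv_yFun, ← ratFun_X, hypInv_ratFun, div_neg]

/-- The even quadratic differentials are the `p(x) dx² / y²` with `p` a polynomial of degree at
most `2g - 2`. -/
theorem exists_polyFun_div_of_even (hg : 1 ≤ g) {A : RatFunc ℂ} (hA : ratFun s A ∈ QuadDiff s) :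
    ∃ p : ℂ[X], p.natDegree ≤ 2 * g - 2 ∧ ratFun s A = polyFun s p / yFun s ^ 2 := by
  rw [mem_quadDiff_iff] at hA
  have hy0 := yFun_ne_zero s
  -- `B = A y²` has no pole at any affine point: at a branch point the double zero of `y²` cancels
  -- the double pole that regularity of `A dx²` allows.
  set B : RatFunc ℂ := A * algebraMap ℂ[X] (RatFunc ℂ) (famPoly s.1) with hB
  have hBA : ratFun s B = ratFun s A * yFun s ^ 2 := by
    rw [hB, map_mul, ← polyFun_apply, ← yFun_sq_eq]
  have hBnd : ratFun s B * polyFun s B.denom = polyFun s B.num := by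
    have hd : algebraMap ℂ[X] (RatFunc ℂ) B.denom ≠ 0 :=
      (map_ne_zero_iff _ (RatFunc.algebraMap_injective ℂ)).mpr B.denom_ne_zero
    rw [polyFun_apply, polyFun_apply, ← map_mul]
    congr 1
    rw [← eq_div_iff hd, RatFunc.num_div_denom]
  have haff : ∀ {a b : ℂ} {hab : b ^ 2 = (famPoly s.1).eval a}
      (t : LocalParam (Point.affine a b hab)), OrderGE (t.expand (ratFun s B)) 0 := by
    intro a b hab t
    rw [hBA, map_mul, map_pow]
    have hA' := hA _ t
    by_cases hb : b = 0
    · have hdx := (hasOrder_dx_branch t hb).pow 2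
      have h2 := (hA'.div hdx).mul ((hasOrder_branch t hb).1.pow 2).orderGE
      rw [mul_div_cancel_right₀ _ hdx.ne_zero] at h2
      exact h2.mono (by norm_num)
    · have hdx := (hasOrder_dx t hb).pow 2
      have h2 := (hA'.div hdx).mul ((hasOrder_expand_yFun_of_ne t hb).pow 2).orderGE
      rw [mul_div_cancel_right₀ _ hdx.ne_zero] at h2
      exact h2.mono (by norm_num)
  -- A root of the denominator is not a root of the coprime numerator, so it would give `B` a pole
  -- at a point above it.
  have hdenom : B.denom = 1 := by
    refine (RatFunc.monic_denom B).natDegree_eq_zero.mp ?_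
    by_contra hdeg
    obtain ⟨a, ha⟩ := IsAlgClosed.exists_root B.denom
      (fun h => hdeg (natDegree_eq_of_degree_eq_some h))
    obtain ⟨b, hab⟩ := exists_point_above s a
    obtain ⟨t⟩ := nonempty_localParam s hg (Point.affine a b hab)
    have hnum : B.num.eval a ≠ 0 := by
      intro h
      obtain ⟨u, w, huw⟩ := RatFunc.isCoprime_num_denom B
      have := congrArg (eval a) huw
      rw [eval_add, eval_mul, eval_mul, h, ha] at this
      simp at this
    have h1 := hasOrder_expand_polyFun t hnum
    rw [← hBnd, map_mul] at h1
    have := h1.le ((haff t).mul (orderGE_expand_polyFun_of_root t ha))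
    norm_num at this
  rw [hdenom, map_one, mul_one] at hBnd
  refine ⟨B.num, ?_, by rw [← hBnd, hBA]; field_simp⟩
  rcases eq_or_ne B.num 0 with h0 | h0
  · rw [h0]; simp
  · obtain ⟨t⟩ := nonempty_localParam s hg .infinity
    have h1 := hasOrder_expand_polyFun_infinity t hg h0
    rw [← hBnd, hBA, map_mul] at h1
    have hdx := (hasOrder_dx_infinity t hg).pow 2
    -- Here `ord A ≥ 6` and `ord y² = -(4g + 2)`, so `B` has order at least `-(4g - 4)`, twice the
    -- claimed degree bound.
    have h2 := ((hA _ t).div hdx).mul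
      ((hasOrder_infinity t hg).2.1.pow 2).orderGE
    rw [mul_div_cancel_right₀ _ hdx.ne_zero, ← map_pow] at h2
    have := h1.le h2
    push_cast at this
    omega

/-! ### The Vandermonde pairing and the range of the Kodaira–Spencer map. -/

/-- The residue of `p(x) dx / y²` at the branch point above `s_i`. -/
theorem residue_polyFun_div_sq (i : Fin (2 * g - 1)) (t : LocalParam (branchPoint s i)) (p : ℂ[X]) :
    t.residue (polyFun s p / yFun s ^ 2) =
      2 / (derivative (famPoly s.1)).eval (s.1 i) * p.eval (s.1 i) := by
  set a := s.1 i with ha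
  set q := famQuot s i with hq
  have hqa : q.eval a ≠ 0 := famQuot_eval_self s i
  -- `k` is chosen so that `p / f = k / (x - a) + r / q` with `r / q` regular at `a`. The factor `2`
  -- in the result is the order of `x - a` at the branch point, and `q(a) = f'(a)`.
  set k := p.eval a / q.eval a with hk
  have hroot : (p - C k * q).eval a = 0 := by
    simp only [eval_sub, eval_mul, eval_C, hk]
    field_simp
    ring
  obtain ⟨r, hr⟩ := dvd_iff_isRoot.mpr hroot
  have hq0 : q ≠ 0 := by rintro h; simp [h] at hqa
  have hl0 : ratFun s (linFrac a) ≠ 0 := polyFun_ne_zero s (X_sub_C_ne_zero a)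
  have hq0' := polyFun_ne_zero s hq0
  have h1 : polyFun s p / yFun s ^ 2 =
      algebraMap ℂ (FunField s) k * ratFun s (linFrac a ^ (-1 : ℤ)) +
        polyFun s r / polyFun s q := by
    have h2 : p = C k * q + (X - C a) * r := by rw [← hr]; ring
    rw [yFun_sq_eq, famPoly_eq_mul_famQuot s i, ← hq, ← ha, map_mul, polyFun_X_sub_C, h2, map_add,
      map_mul, map_mul, polyFun_C, polyFun_X_sub_C, zpow_neg_one, map_inv₀]
    field_simp
  have h3 : t.residue (polyFun s r / polyFun s q) = 0 := by
    apply t.residue_eq_zero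
    rw [map_div₀]
    exact (((orderGE_expand_polyFun t r).div (hasOrder_expand_polyFun t hqa)).mul
      (orderGE_dx t)).mono (by norm_num)
  rw [h1, t.residue_add, h3, t.residue_const_mul,
    t.residue_linFrac_inv (hasOrder_branch t rfl).2, ha, famPoly_deriv_eval_s, ← ha, ← hq, hk]
  push_cast
  ring

/-- The even quadratic differential `x^j dx² / y²`. -/
def evenMonomial (hg : 1 ≤ g) (s : Base g) (j : Fin (2 * g - 1)) : QuadDiff s :=
  ⟨_, xFun_pow_div_sq_mem_quadDiff hg j⟩

theorem branchResidue_evenMonomial (hg : 1 ≤ g) (i j : Fin (2 * g - 1)) :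
    branchResidue hg s i (evenMonomial hg s j) =
      2 / (derivative (famPoly s.1)).eval (s.1 i) * s.1 i ^ (j : ℕ) := by
  obtain ⟨t⟩ := nonempty_localParam s hg (branchPoint s i)
  rw [branchResidue_apply hg i t, evenMonomial]
  have := residue_polyFun_div_sq i t (X ^ (j : ℕ))
  rwa [map_pow, polyFun_X, eval_pow, eval_X] at this

theorem exists_eq_sum_evenMonomial (hg : 1 ≤ g) {A : RatFunc ℂ} (hA : ratFun s A ∈ QuadDiff s) :
    ∃ c : Fin (2 * g - 1) → ℂ,
      (⟨ratFun s A, hA⟩ : QuadDiff s) = ∑ j, c j • evenMonomial hg s j := by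
  obtain ⟨p, hp, h⟩ := exists_polyFun_div_of_even hg hA
  refine ⟨fun j => p.coeff j, Subtype.ext ?_⟩
  rw [AddSubmonoidClass.coe_finsetSum]
  simp only [Submodule.coe_smul, evenMonomial, Algebra.smul_def]
  rw [h, p.as_sum_range' (2 * g - 1) (by omega), map_sum, Finset.sum_div,
    Fin.sum_univ_eq_sum_range
      (fun j => algebraMap ℂ (FunField s) ((∑ i ∈ Finset.range (2 * g - 1),
        monomial i (p.coeff i)).coeff j) * (xFun s ^ j / yFun s ^ 2)),
    ← p.as_sum_range' (2 * g - 1) (by omega)]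
  refine Finset.sum_congr rfl fun j _ => ?_
  rw [← C_mul_X_pow_eq_monomial, map_mul, map_pow, polyFun_X, polyFun_C, mul_div_assoc]

/-- The conditions say that the vector `2 v_i / f'(s_i)` is killed by the Vandermonde matrix of the
distinct `s_i`. -/
theorem kodairaSpencer_evenMonomial_injective (hg : 1 ≤ g) {v : Tangent g}
    (h : ∀ j, kodairaSpencer hg s v (evenMonomial hg s j) = 0) : v = 0 := by
  have h0 := Matrix.eq_zero_of_forall_pow_sum_mul_pow_eq_zero (R := ℂ) s.2.2
    (v := fun i => v i * (2 / (derivative (famPoly s.1)).eval (s.1 i))) (fun j => by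
      have := h j
      rw [kodairaSpencer_apply] at this
      simpa only [branchResidue_evenMonomial, mul_assoc] using this)
  ext i
  have h1 := congrFun h0 i
  have h2 := famPoly_deriv_eval_ne_zero s (famPoly_eval_s s i)
  simpa [h2] using h1

theorem kodairaSpencer_odd (hg : 1 ≤ g) (v : Tangent g) {q : QuadDiff s}
    (hq : q ∈ OddQuadDiff s) : kodairaSpencer hg s v q = 0 := by
  rw [kodairaSpencer_apply]
  exact Finset.sum_eq_zero fun i _ => by rw [branchResidue_odd hg i hq, mul_zero]

theorem kodairaSpencer_injective (hg : 1 ≤ g) (s : Base g) :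
    Function.Injective (kodairaSpencer hg s) := by
  rw [injective_iff_map_eq_zero]
  intro v hv
  exact kodairaSpencer_evenMonomial_injective hg fun j => by rw [hv]; rfl

/-- A functional vanishing on odd differentials is determined by its values on the `2g - 1` even
monomials. The pairing `L` of tangent vectors with these is injective between spaces of equal
dimension, so all such values occur. -/
theorem range_kodairaSpencer (hg : 1 ≤ g) (s : Base g) :
    LinearMap.range (kodairaSpencer hg s) = (OddQuadDiff s).dualAnnihilator := by
  apply le_antisymm
  · rintro _ ⟨v, rfl⟩
    rw [Submodule.mem_dualAnnihilator]
    exact fun q hq => kodairaSpencer_odd hg v hq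
  · intro φ hφ
    rw [Submodule.mem_dualAnnihilator] at hφ
    let L : Tangent g →ₗ[ℂ] (Fin (2 * g - 1) → ℂ) :=
      LinearMap.pi fun j => (LinearMap.applyₗ (evenMonomial hg s j)).comp (kodairaSpencer hg s)
    have hL : Function.Injective L := by
      rw [injective_iff_map_eq_zero]
      intro v hv
      exact kodairaSpencer_evenMonomial_injective hg fun j => congrFun hv j
    obtain ⟨v, hv⟩ := LinearMap.injective_iff_surjective.mp hL fun j => φ (evenMonomial hg s j)
    refine ⟨v, LinearMap.ext fun q => ?_⟩
    obtain ⟨A, hA, o, ho, rfl⟩ := exists_even_add_odd q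
    obtain ⟨c, hc⟩ := exists_eq_sum_evenMonomial hg hA
    rw [map_add, map_add, kodairaSpencer_odd hg v ho, hφ o ho, hc, map_sum, map_sum]
    congr 1
    refine Finset.sum_congr rfl fun j _ => ?_
    rw [map_smul, map_smul]
    congr 1
    exact congrFun hv j

end QuadraticDifferentials

end HyperellipticKS

end


theorem proposition7p1 (g : ℕ) (hg : 1 ≤ g) (s : HyperellipticKS.Base g) :
    ∃ θ : HyperellipticKS.Tangent g →ₗ[ℂ] Module.Dual ℂ (HyperellipticKS.QuadDiff s),
      HyperellipticKS.IsKodairaSpencer s θ ∧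
      (∀ i : Fin (2 * g - 1), ∃ c : ℂ, c ≠ 0 ∧ ∀ j : Fin (2 * g - 1),
        ∃ hj : HyperellipticKS.xFun s ^ (j : ℕ) / HyperellipticKS.yFun s ^ 2 ∈
            HyperellipticKS.QuadDiff s,
          θ (Pi.single i 1) ⟨_, hj⟩ = c * s.1 i ^ (j : ℕ)) ∧
      (∀ i : Fin (2 * g - 1), ∀ j : ℕ, j + 3 ≤ g →
        ∃ hj : HyperellipticKS.xFun s ^ j / HyperellipticKS.yFun s ∈ HyperellipticKS.QuadDiff s,
          θ (Pi.single i 1) ⟨_, hj⟩ = 0) ∧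
      Function.Injective θ ∧
      LinearMap.range θ = (HyperellipticKS.OddQuadDiff s).dualAnnihilator := by
  refine ⟨HyperellipticKS.kodairaSpencer hg s, HyperellipticKS.isKodairaSpencer hg s,
    fun i => ⟨2 / (derivative (HyperellipticKS.famPoly s.1)).eval (s.1 i), ?_, fun j =>
      ⟨HyperellipticKS.xFun_pow_div_sq_mem_quadDiff hg j, ?_⟩⟩,
    fun i j hj => ⟨HyperellipticKS.xFun_pow_div_mem_quadDiff hg hj, ?_⟩,
    HyperellipticKS.kodairaSpencer_injective hg s, HyperellipticKS.range_kodairaSpencer hg s⟩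
  · exact div_ne_zero two_ne_zero
      (HyperellipticKS.famPoly_deriv_eval_ne_zero s (HyperellipticKS.famPoly_eval_s s i))
  · rw [HyperellipticKS.kodairaSpencer_single]
    exact HyperellipticKS.branchResidue_evenMonomial hg i j
  · exact HyperellipticKS.kodairaSpencer_odd hg _
      (HyperellipticKS.xFun_pow_div_mem_oddQuadDiff _)
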